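/- Let $1/2<\alpha<1$, $0<T<\infty$, and let $\mathcal H$ be a separable (real or complex) Hilbert space with an orthonormal basis $\{e_\xi\}_{\xi\in\mathcal I}$, $\mathcal I$ countable. Let $\lambda_\xi\ge c_L>0$ and $\mu_\xi\ge c_M>0$ $(\xi\in\mathcal I)$ be real numbers, and let $\mathcal L,\mathcal M$ be the operators that are diagonal in this basis, $\mathcal Lu=\sum_\xi\lambda_\xi(u,e_\xi)e_\xi$ and $\mathcal Mu=\sum_\xi\mu_\xi(u,e_\xi)e_\xi$, on their maximal domains. For $l,m\in\mathbb R$ let $\mathcal H^{l,m}_{\mathcal L,\mathcal M}=\{u\in\mathcal H:\mathcal L^l\mathcal M^mu\in\mathcal H\}$ with the graph norm, where $\mathcal L^l\mathcal M^m$ is the diagonal operator with eigenvalues $\lambda_\xi^l\mu_\xi^m$; $\mathcal H^1_{\mathcal L}$ and $\mathcal H^1_{\mathcal M}$ are the domains of $\mathcal L$ and $\mathcal M$ with their graph norms. For a Hilbert space $X$ and $g:[0,T]\to X$ integrable, we say that an integrable $v:(0,T)\to X$ is the (generalised) Caputo derivative $\mathcal D_t^\alpha g$ if $$\frac1{\Gamma(1-\alpha)}\int_0^t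 (t-s)^{-\alpha}\,[g(s)-g(0)]\,ds=\int_0^t v(s)\,ds\qquad\text{for a.e. }t\in(0,T)$$ (for absolutely continuous $g$ this is $\mathcal D_t^\alpha g(t)=\frac1{\Gamma(1-\alpha)}\int_0^t(t-s)^{-\alpha}g'(s)\,ds$). Let $W^\alpha(0,T;X)$ be the space of all $g\in L^2(0,T;X)$ with $\mathcal D_t^\alpha g\in L^2(0,T;X)$. Let $\varphi\in\mathcal H^1_{\mathcal L}\cap\mathcal H^1_{\mathcal M}$ and $f\in L^2(0,T;\mathcal H)\cap L^2(0,T;\mathcal H^{-1,1}_{\mathcal L,\mathcal M})$. Then there is a function $u$, unique up to equality for almost every $t\in(0,T)$, such that $u\in L^2(0,T;\mathcal H^1_{\mathcal M})\cap W^\alpha(0,T;\mathcal H^1_{\mathcal L})$ and $$\mathcal D_t^\alpha[u(t)+\mathcal Lu(t)]+\mathcal Mu(t)=f(t)\ \text{ in }\mathcal H\text{ for a.e. }t\in(0,T),\qquad u(0)=\varphi .$$ It can be chosen so that for every $t\in[0,T]$ $$u(t)=\sum_{\xi\in\mathcal I}\varphi_\xi\,E_{\alpha,1}\!\left(-\tfrac{\mu_\xi}{1+\lambda_\xi}t^\alpha\right)e_\xi+\sum_{\xi\in\mathcal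 I}\left[\frac1{1+\lambda_\xi}\int_0^t s^{\alpha-1}E_{\alpha,\alpha}\!\left(-\tfrac{\mu_\xi}{1+\lambda_\xi}s^\alpha\right)f_\xi(t-s)\,ds\right]e_\xi ,$$ where both series converge in $\mathcal H$, $\varphi_\xi=(\varphi,e_\xi)$, $f_\xi(t)=(f(t),e_\xi)$, and $E_{\alpha,\beta}(z)=\sum_{m\ge0}z^m/\Gamma(\alpha m+\beta)$. -/

import Mathlib

open MeasureTheory

section DiagonalOperators

variable {𝕜 ι H : Type*} [RCLike 𝕜] [NormedAddCommGroup H] [InnerProductSpace 𝕜 H]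

/-- The maximal domain of the operator that is diagonal in the orthonormal basis `e` with real
eigenvalues `a ξ`: all `u` for which the sequence `a ξ (u, e ξ)` is square summable. -/
def diagonalDomain (e : HilbertBasis ι 𝕜 H) (a : ι → ℝ) : Submodule 𝕜 H where
  carrier := {u | Memℓp (fun ξ => (a ξ : 𝕜) * e.repr u ξ) 2}
  add_mem' {u v} hu hv := by
    have h := Memℓp.add hu hv
    refine (congrArg (fun g : ι → 𝕜 => Memℓp g 2) (funext fun ξ => ?_)).mp h
    simp [mul_add]
  zero_mem' := by
    refine (congrArg (fun g : ι → 𝕜 => Memℓp g 2) (funext fun ξ => ?_)).mp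
      (zero_memℓp : Memℓp (0 : ι → 𝕜) 2)
    simp
  smul_mem' c u hu := by
    have h := Memℓp.const_smul hu c
    refine (congrArg (fun g : ι → 𝕜 => Memℓp g 2) (funext fun ξ => ?_)).mp h
    simp [mul_left_comm]

/-- The operator that is diagonal in the orthonormal basis `e` with real eigenvalues `a ξ`:
`A u = ∑ ξ, a ξ (u, e ξ) e ξ`, on its maximal domain. -/
noncomputable def diagonalOperator (e : HilbertBasis ι 𝕜 H) (a : ι → ℝ) : H →ₗ.[𝕜] H where
  domain := diagonalDomain e a
  toFun :=
    { toFun := fun u => e.repr.symm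
        (⟨fun ξ => (a ξ : 𝕜) * e.repr (u : H) ξ, u.2⟩ : lp (fun _ : ι => 𝕜) 2)
      map_add' := fun u v => by
        rw [← map_add]
        refine congrArg _ (Subtype.ext (funext fun ξ => ?_))
        change (a ξ : 𝕜) * e.repr ((u : H) + v) ξ
          = (a ξ : 𝕜) * e.repr (u : H) ξ + (a ξ : 𝕜) * e.repr (v : H) ξ
        simp [mul_add]
      map_smul' := fun c u => by
        rw [RingHom.id_apply, ← map_smul]
        refine congrArg _ (Subtype.ext (funext fun ξ => ?_))
        change (a ξ : 𝕜) * e.repr (c • (u : H)) ξ = c * ((a ξ : 𝕜) * e.repr (u : H) ξ)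
        simp [mul_left_comm] }

/-- The joint power `L ^ l M ^ m` of the operators `L`, `M` that are diagonal in the basis `e` with
positive eigenvalues `lam ξ`, `mu ξ`. Its domain is the space `H^{l,m}_{L,M}`, that is the set of
all `u ∈ H` with `L ^ l M ^ m u ∈ H`. -/
noncomputable def jointPower (e : HilbertBasis ι 𝕜 H) (lam mu : ι → ℝ) (l m : ℝ) : H →ₗ.[𝕜] H :=
  diagonalOperator e fun ξ => lam ξ ^ l * mu ξ ^ m

open Classical in
/-- The value `A u` of a partially defined operator; it is only meaningful for `u` in the domain
of `A`, and set to `0` elsewhere. -/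
noncomputable def opApply (A : H →ₗ.[𝕜] H) (u : H) : H :=
  if h : u ∈ A.domain then A ⟨u, h⟩ else 0

/-- `u ∈ L²(0,T; D(A))`, where `D(A)` is the domain of `A` with the graph norm. -/
def MemL2Domain (A : H →ₗ.[𝕜] H) (T : ℝ) (u : ℝ → H) : Prop :=
  (∀ᵐ t ∂volume.restrict (Set.Ioc 0 T), u t ∈ A.domain) ∧
    MemLp u 2 (volume.restrict (Set.Ioc 0 T)) ∧
    MemLp (fun t => opApply A (u t)) 2 (volume.restrict (Set.Ioc 0 T))

end DiagonalOperators

section FractionalCalculus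

variable {X : Type*} [NormedAddCommGroup X] [NormedSpace ℝ X]

/-- The Riemann-Liouville fractional integral
`I^β[g](t) = 1 / Γ(β) ∫_0^t (t - s)^(β - 1) g(s) ds`. -/
noncomputable def rlIntegral (β : ℝ) (g : ℝ → X) (t : ℝ) : X :=
  (Real.Gamma β)⁻¹ • ∫ s in (0 : ℝ)..t, (t - s) ^ (β - 1) • g s

/-- `v` is the Caputo derivative of order `0 < α < 1` of `g : [0,T] → X`, in the generalised sense
`v = d/dt I^(1-α)[g - g(0)]`: the function `I^(1-α)[g - g(0)]` agrees almost everywhere on `(0,T)`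
with the absolutely continuous function that vanishes at `0` and has the derivative `v`.
If `g` is absolutely continuous, then `I^(1-α)[g - g(0)](t) = ∫_0^t I^(1-α)[g'](s) ds`, so that
`v = I^(1-α)[g']`, the Caputo derivative of a differentiable function. -/
def HasCaputoDeriv (α T : ℝ) (g v : ℝ → X) : Prop :=
  IntegrableOn g (Set.Ioc 0 T) ∧ IntegrableOn v (Set.Ioc 0 T) ∧
    ∀ᵐ t ∂volume.restrict (Set.Ioc 0 T),
      rlIntegral (1 - α) (fun s => g s - g 0) t = ∫ s in (0 : ℝ)..t, v s

/-- The Mittag-Leffler function `E_{α,β}(z) = ∑ z ^ m / Γ(α m + β)`. -/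
noncomputable def mittagLeffler (α β z : ℝ) : ℝ :=
  ∑' m : ℕ, z ^ m / Real.Gamma (α * m + β)

end FractionalCalculus

section Problem

variable {𝕜 H : Type*} [RCLike 𝕜] [NormedAddCommGroup H] [InnerProductSpace 𝕜 H] [NormedSpace ℝ H]

/-- `u ∈ W^α(0,T; D(A))`: both `u` and its Caputo derivative are in `L²(0,T; D(A))`.
The Caputo derivative is the one of a function with values in `D(A)`: in the graph norm, this means
that `v` is the derivative of `u` and `A v` that of `A u`. -/
def MemWDomain (A : H →ₗ.[𝕜] H) (α T : ℝ) (u : ℝ → H) : Prop :=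
  u 0 ∈ A.domain ∧ MemL2Domain A T u ∧
    ∃ v : ℝ → H, MemL2Domain A T v ∧ HasCaputoDeriv α T u v ∧
      HasCaputoDeriv α T (fun t => opApply A (u t)) (fun t => opApply A (v t))

/-- Generalised solutions of `D_t^α [u + L u] + M u = f` on `(0,T)`, `u(0) = φ`: functions
`u ∈ L²(0,T; D(M)) ∩ W^α(0,T; D(L))` that have the initial value `φ` and satisfy the equation in `H`
for almost every `t`. -/
structure IsGeneralisedSolution (L M : H →ₗ.[𝕜] H) (α T : ℝ) (f : ℝ → H) (φ : H)
    (u : ℝ → H) : Prop where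
  memL2 : MemL2Domain M T u
  memW : MemWDomain L α T u
  initial : u 0 = φ
  equation : ∃ g : ℝ → H, HasCaputoDeriv α T (fun t => u t + opApply L (u t)) g ∧
    ∀ᵐ t ∂volume.restrict (Set.Ioc 0 T), g t + opApply M (u t) = f t

end Problem

/-! In the basis `e` the problem decouples: the ξ-th coordinate solves the fractional relaxation
equation D^α y = h - c y with c = μ/(1+λ) and h = f_ξ/(1+λ). Write k_β for `fracKernel β` and e_c
for `mlKernel α α c`. The only solution, up to null sets, is y = E_{α,1}(-c t^α) y(0) + e_c * h.
Existence rests on `causalConv_fracKernel_mlKernel` (fractional integration only shifts the second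
Mittag-Leffler index), on `mlKernel_recursion` and on associativity of convolution. For uniqueness,
convolving the homogeneous equation with e_c leaves 1 * y = 0.

Reassembling the coordinates in `H` needs bounds uniform in ξ, and these come from the positivity of
e_c (`mlKernel_pos`), proved from the Volterra equation e_c = k_α - c k_α * e_c. It yields 0 < e_c ≤
k_α, 0 ≤ E_{α,1}(-c t^α) ≤ 1 and c ∫ e_c ≤ 1. The second bound controls the part coming from φ, in
D(L) and in D(M). By Young's inequality the third makes c e_c * f_ξ no larger than f_ξ in L²; since
μ e_c * h = c e_c * f_ξ, the part coming from f lies in L²(0,T; D(M)). The derivative (f - Mu)/(1+L)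
then stays in L²(0,T; D(L)) because λ/(1+λ) ≤ 1. Finally, α > 1/2 puts k_α in L²(0,T), so by
Cauchy-Schwarz the second series converges at every t, not just at almost every t. -/

/-! ### Convolution on the half line: associativity, Cauchy-Schwarz, Young. -/

section CausalConvolution

open Set ContinuousLinearMap
open scoped Convolution

variable {X : Type*} [NormedAddCommGroup X] [NormedSpace ℝ X]

/-- The convolution `∫_0^t k (t - s) g s ds` of functions on the half line. -/
noncomputable def causalConv (k : ℝ → ℝ) (g : ℝ → X) (t : ℝ) : X :=
  ∫ s in (0 : ℝ)..t, k (t - s) • g s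

/-- The bilinear map `(x, c) ↦ c • x`, for convolutions with a scalar kernel on the right. -/
noncomputable abbrev smulFlip (X : Type*) [NormedAddCommGroup X] [NormedSpace ℝ X] :
    X →L[ℝ] ℝ →L[ℝ] X :=
  (lsmul ℝ ℝ : ℝ →L[ℝ] X →L[ℝ] X).flip

/-- Extending both factors by zero outside (0,T] cuts the whole-line convolution integral down to
(0,t) as long as t ≤ T, so the theory of convolution on ℝ becomes available. The interval is open at
t because the kernel is cut off at 0. -/
theorem indicator_smul_indicator_eq {k : ℝ → ℝ} {g : ℝ → X} {t T : ℝ} (ht : t ≤ T) (s : ℝ) :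
    (Ioc 0 T).indicator k (t - s) • (Ioc 0 T).indicator g s
      = (Ioo 0 t).indicator (fun s => k (t - s) • g s) s := by
  by_cases hs : s ∈ Ioo 0 t
  · have h1 : t - s ∈ Ioc 0 T := ⟨by linarith [hs.2], by linarith [hs.1]⟩
    have h2 : s ∈ Ioc 0 T := ⟨hs.1, by linarith [hs.2]⟩
    simp [hs, h1, h2]
  · rw [indicator_of_notMem hs]
    by_cases h0 : 0 < s
    · have : t - s ∉ Ioc 0 T := fun h => hs ⟨h0, by linarith [h.1]⟩
      simp [this]
    · have : s ∉ Ioc 0 T := fun h => h0 h.1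
      simp [this]

theorem convolution_indicator_eq {k : ℝ → ℝ} {g : ℝ → X} {t T : ℝ} (ht0 : 0 ≤ t) (ht : t ≤ T) :
    ((Ioc 0 T).indicator g ⋆[smulFlip X, volume] (Ioc 0 T).indicator k) t = causalConv k g t := by
  rw [convolution_def, causalConv, intervalIntegral.integral_of_le ht0,
    integral_Ioc_eq_integral_Ioo, ← integral_indicator measurableSet_Ioo]
  exact integral_congr_ae (.of_forall fun s => indicator_smul_indicator_eq ht s)

theorem convolution_indicator_eq_zero {k : ℝ → ℝ} {g : ℝ → X} {t T : ℝ} (ht : t ≤ 0) :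
    ((Ioc 0 T).indicator g ⋆[smulFlip X, volume] (Ioc 0 T).indicator k) t = 0 := by
  rw [convolution_def]
  refine integral_eq_zero_of_ae (.of_forall fun r => ?_)
  by_cases hr : r ∈ Ioc 0 T
  · have : t - r ∉ Ioc 0 T := fun h => by linarith [h.1, hr.1]
    simp [this]
  · simp [hr]

theorem causalConv_integrand_ae {k : ℝ → ℝ} {g : ℝ → X} {T : ℝ} (hk : IntegrableOn k (Ioc 0 T))
    (hg : IntegrableOn g (Ioc 0 T)) :
    ∀ᵐ t ∂volume.restrict (Ioc 0 T),
      IntervalIntegrable (fun s => k (t - s) • g s) volume 0 t := by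
  have h := Integrable.ae_convolution_exists (smulFlip X)
    ((integrable_indicator_iff measurableSet_Ioc).2 hg)
    ((integrable_indicator_iff measurableSet_Ioc).2 hk)
  filter_upwards [ae_restrict_of_ae h, ae_restrict_mem measurableSet_Ioc] with t h1 ht
  rw [intervalIntegrable_iff_integrableOn_Ioo_of_le ht.1.le,
    ← integrable_indicator_iff measurableSet_Ioo]
  exact Integrable.congr h1 (.of_forall fun s => indicator_smul_indicator_eq ht.2 s)

theorem integrableOn_causalConv {k : ℝ → ℝ} {g : ℝ → X} {T : ℝ} (hk : IntegrableOn k (Ioc 0 T))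
    (hg : IntegrableOn g (Ioc 0 T)) : IntegrableOn (causalConv k g) (Ioc 0 T) := by
  have h := Integrable.integrable_convolution (smulFlip X)
    ((integrable_indicator_iff measurableSet_Ioc).2 hg)
    ((integrable_indicator_iff measurableSet_Ioc).2 hk)
  refine h.integrableOn.congr_fun (fun t ht => ?_) measurableSet_Ioc
  exact convolution_indicator_eq ht.1.le ht.2

theorem causalConv_congr {k k' : ℝ → ℝ} {g g' : ℝ → X} {t T : ℝ} (ht : t ∈ Icc 0 T)
    (hk : ∀ s ∈ Ioc 0 T, k s = k' s) (hg : g =ᵐ[volume.restrict (Ioc 0 T)] g') :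
    causalConv k g t = causalConv k' g' t := by
  rw [← convolution_indicator_eq ht.1 ht.2, ← convolution_indicator_eq ht.1 ht.2,
    convolution_def, convolution_def]
  have h1 : (Ioc 0 T).indicator k = (Ioc 0 T).indicator k' := indicator_congr hk
  rw [h1]
  refine integral_congr_ae ?_
  filter_upwards [(ae_restrict_iff' measurableSet_Ioc).1 hg] with s hs
  by_cases h : s ∈ Ioc 0 T
  · simp [h, hs h]
  · simp [h]

theorem causalConv_eq_integral_comp_sub (k : ℝ → ℝ) (g : ℝ → X) (t : ℝ) :
    causalConv k g t = ∫ s in (0 : ℝ)..t, k s • g (t - s) := by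
  have h := intervalIntegral.integral_comp_sub_left (a := 0) (b := t)
    (fun s => k (t - s) • g s) t
  simp only [sub_sub_cancel, sub_self, sub_zero] at h
  exact h.symm

theorem causalConv_comm (k l : ℝ → ℝ) (t : ℝ) : causalConv k l t = causalConv l k t := by
  rw [causalConv_eq_integral_comp_sub, causalConv]
  exact intervalIntegral.integral_congr fun s _ => by simp [mul_comm]

/-- Associativity on ℝ needs the triple convolution of absolute values to exist at t, which Fubini
grants only for almost every t. -/
theorem causalConv_assoc [CompleteSpace X] {k l : ℝ → ℝ} {g : ℝ → X} {T : ℝ}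
    (hk : IntegrableOn k (Ioc 0 T)) (hl : IntegrableOn l (Ioc 0 T))
    (hg : IntegrableOn g (Ioc 0 T)) :
    ∀ᵐ t ∂volume.restrict (Ioc 0 T),
      causalConv k (causalConv l g) t = causalConv (causalConv k l) g t := by
  have hk' := (integrable_indicator_iff measurableSet_Ioc).2 hk
  have hl' := (integrable_indicator_iff measurableSet_Ioc).2 hl
  have hg' := (integrable_indicator_iff measurableSet_Ioc).2 hg
  have h := Integrable.ae_convolution_exists (mul ℝ ℝ) hg'.norm
    (Integrable.integrable_convolution (mul ℝ ℝ) hl'.norm hk'.norm)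
  filter_upwards [ae_restrict_of_ae h, ae_restrict_mem measurableSet_Ioc] with t h1 ht
  have key := convolution_assoc (smulFlip X) (smulFlip X) (smulFlip X) (smulFlip ℝ)
    (fun x y z => by simp [smul_smul, mul_comm]) hg'.1 hl'.1 hk'.1
    (Integrable.ae_convolution_exists (smulFlip X) hg' hl')
    (Integrable.ae_convolution_exists (mul ℝ ℝ) hl'.norm hk'.norm) h1
  have e1 : ∀ s ∈ Ioc 0 T, ((Ioc 0 T).indicator g ⋆[smulFlip X, volume] (Ioc 0 T).indicator l) s
      = causalConv l g s := fun s hs => convolution_indicator_eq hs.1.le hs.2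
  have e2 : ∀ s ∈ Ioc 0 T, ((Ioc 0 T).indicator l ⋆[smulFlip ℝ, volume] (Ioc 0 T).indicator k) s
      = causalConv k l s := fun s hs => convolution_indicator_eq hs.1.le hs.2
  rw [← convolution_indicator_eq ht.1.le ht.2, ← convolution_indicator_eq ht.1.le ht.2]
  -- The inner whole-line convolution does not vanish beyond T, so it differs from the truncated
  -- one; for t ≤ T the other factor is zero there. `a2` is the mirror image.
  have a1 : ((Ioc 0 T).indicator (causalConv l g) ⋆[smulFlip X, volume] (Ioc 0 T).indicator k) t
      = (((Ioc 0 T).indicator g ⋆[smulFlip X, volume] (Ioc 0 T).indicator l)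
          ⋆[smulFlip X, volume] (Ioc 0 T).indicator k) t := by
    rw [convolution_def, convolution_def]
    refine integral_congr_ae (.of_forall fun s => ?_)
    by_cases hs : s ∈ Ioc 0 T
    · simp [hs, e1 s hs]
    · rcases le_or_gt s 0 with h0 | h0
      · simp [hs, convolution_indicator_eq_zero h0]
      · have : t - s ∉ Ioc 0 T := fun h => hs ⟨h0, by linarith [h.1, ht.2]⟩
        simp [this]
  have a2 : ((Ioc 0 T).indicator g ⋆[smulFlip X, volume] (Ioc 0 T).indicator (causalConv k l)) t
      = ((Ioc 0 T).indicator g ⋆[smulFlip X, volume]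
        ((Ioc 0 T).indicator l ⋆[smulFlip ℝ, volume] (Ioc 0 T).indicator k)) t := by
    rw [convolution_def, convolution_def]
    refine integral_congr_ae (.of_forall fun s => ?_)
    by_cases hs : t - s ∈ Ioc 0 T
    · simp [hs, e2 _ hs]
    · rcases le_or_gt (t - s) 0 with h0 | h0
      · simp [hs, convolution_indicator_eq_zero h0]
      · have : s ∉ Ioc 0 T := fun h => hs ⟨h0, by linarith [h.1, ht.2]⟩
        simp [this]
  rw [a1, a2, key]

theorem causalConv_one (g : ℝ → X) (t : ℝ) :
    causalConv (fun _ => 1) g t = ∫ s in (0 : ℝ)..t, g s := by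
  simp [causalConv]

theorem enorm_causalConv_le (k : ℝ → ℝ) (g : ℝ → X) {t : ℝ} (ht : 0 ≤ t) :
    ‖causalConv k g t‖ₑ ≤ ∫⁻ s in Ioc 0 t, ‖k (t - s)‖ₑ * ‖g s‖ₑ := by
  rw [causalConv, intervalIntegral.integral_of_le ht]
  exact (enorm_integral_le_lintegral_enorm _).trans_eq (by simp only [enorm_smul])

theorem ENNReal.sq_lintegral_mul_le {α : Type*} [MeasurableSpace α] (μ : Measure α)
    {f g : α → ENNReal} (hf : AEMeasurable f μ) (hg : AEMeasurable g μ) :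
    (∫⁻ a, f a * g a ∂μ) ^ 2 ≤ (∫⁻ a, f a ^ 2 ∂μ) * ∫⁻ a, g a ^ 2 ∂μ := by
  have h := ENNReal.lintegral_mul_le_Lp_mul_Lq μ Real.HolderConjugate.two_two hf hg
  have e : ∀ x : ENNReal, (x ^ (1 / 2 : ℝ)) ^ 2 = x := fun x => by
    rw [← ENNReal.rpow_natCast, ← ENNReal.rpow_mul]; norm_num
  calc (∫⁻ a, f a * g a ∂μ) ^ 2
      ≤ ((∫⁻ a, f a ^ (2 : ℝ) ∂μ) ^ (1 / 2 : ℝ) * (∫⁻ a, g a ^ (2 : ℝ) ∂μ) ^ (1 / 2 : ℝ)) ^ 2 := by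
        gcongr; exact h
    _ = _ := by simp only [mul_pow, e, ENNReal.rpow_two]

theorem lintegral_comp_sub_left_Ioc_le {F : ℝ → ENNReal} {t T : ℝ} (ht : t ≤ T) :
    ∫⁻ s in Ioc 0 t, F (t - s) ≤ ∫⁻ s in Ioc 0 T, F s := by
  rw [restrict_Ioo_eq_restrict_Ioc.symm, ← lintegral_indicator measurableSet_Ioo,
    ← lintegral_indicator measurableSet_Ioc,
    ← lintegral_sub_left_eq_self ((Ioc 0 T).indicator F) t]
  refine lintegral_mono fun s => ?_
  by_cases hs : s ∈ Ioo 0 t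
  · have : t - s ∈ Ioc 0 T := ⟨by linarith [hs.2], by linarith [hs.1]⟩
    simp [hs, this]
  · simp [hs]

theorem aestronglyMeasurable_comp_sub_left {k : ℝ → ℝ} {t T : ℝ} (ht : t ≤ T)
    (hk : AEStronglyMeasurable k (volume.restrict (Ioc 0 T))) :
    AEStronglyMeasurable (fun s => k (t - s)) (volume.restrict (Ioc 0 t)) := by
  have h1 := (aestronglyMeasurable_indicator_iff measurableSet_Ioc).2 hk
  have h2 : AEStronglyMeasurable (fun s => (Ioc 0 T).indicator k (t - s)) volume :=
    h1.comp_quasiMeasurePreserving (quasiMeasurePreserving_sub_left volume t)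
  rw [← restrict_Ioo_eq_restrict_Ioc]
  refine (h2.restrict (s := Ioo 0 t)).congr ?_
  filter_upwards [ae_restrict_mem measurableSet_Ioo] with s hs
  have : t - s ∈ Ioc 0 T := ⟨by linarith [hs.2], by linarith [hs.1]⟩
  simp [this]

/-- The Cauchy-Schwarz inequality for the convolution of square integrable functions. -/
theorem enorm_causalConv_sq_le {k : ℝ → ℝ} {g : ℝ → X} {t T : ℝ} (ht : t ∈ Icc 0 T)
    (hk : AEStronglyMeasurable k (volume.restrict (Ioc 0 T)))
    (hg : AEStronglyMeasurable g (volume.restrict (Ioc 0 T))) :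
    ‖causalConv k g t‖ₑ ^ 2
      ≤ (∫⁻ s in Ioc 0 T, ‖k s‖ₑ ^ 2) * ∫⁻ s in Ioc 0 T, ‖g s‖ₑ ^ 2 := by
  have hsub : Ioc 0 t ⊆ Ioc 0 T := Ioc_subset_Ioc_right ht.2
  calc ‖causalConv k g t‖ₑ ^ 2 ≤ (∫⁻ s in Ioc 0 t, ‖k (t - s)‖ₑ * ‖g s‖ₑ) ^ 2 := by
        gcongr; exact enorm_causalConv_le k g ht.1
    _ ≤ (∫⁻ s in Ioc 0 t, ‖k (t - s)‖ₑ ^ 2) * ∫⁻ s in Ioc 0 t, ‖g s‖ₑ ^ 2 :=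
        ENNReal.sq_lintegral_mul_le _ (aestronglyMeasurable_comp_sub_left ht.2 hk).enorm
          (hg.mono_set hsub).enorm
    _ ≤ _ :=
        mul_le_mul' (lintegral_comp_sub_left_Ioc_le (F := fun s => ‖k s‖ₑ ^ 2) ht.2)
          (lintegral_mono_set hsub)

/-- Young's inequality `‖k * g‖_{L²} ≤ ‖k‖_{L¹} ‖g‖_{L²}` for the convolution on `(0,T)`. -/
theorem lintegral_enorm_causalConv_sq_le {k : ℝ → ℝ} {g : ℝ → X} {T : ℝ}
    (hk : AEStronglyMeasurable k (volume.restrict (Ioc 0 T)))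
    (hg : AEStronglyMeasurable g (volume.restrict (Ioc 0 T))) :
    ∫⁻ t in Ioc 0 T, ‖causalConv k g t‖ₑ ^ 2
      ≤ (∫⁻ s in Ioc 0 T, ‖k s‖ₑ) ^ 2 * ∫⁻ s in Ioc 0 T, ‖g s‖ₑ ^ 2 := by
  set A := ∫⁻ s in Ioc 0 T, ‖k s‖ₑ with hA
  set K : ℝ → ENNReal := (Ioc 0 T).indicator fun s => ‖k s‖ₑ with hK
  set G : ℝ → ENNReal := (Ioc 0 T).indicator fun s => ‖g s‖ₑ ^ 2 with hG
  have hKm : AEMeasurable K volume := (aemeasurable_indicator_iff measurableSet_Ioc).2 hk.enorm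
  have hGm : AEMeasurable G volume :=
    (aemeasurable_indicator_iff measurableSet_Ioc).2 (hg.enorm.pow_const 2)
  -- Cauchy-Schwarz with weight |k(t-s)|: splitting |k||g| as |k|^(1/2) · (|k|^(1/2)|g|) yields one
  -- factor ‖k‖₁; Tonelli yields the other after integration in t.
  have hpt : ∀ t ∈ Ioc 0 T, ‖causalConv k g t‖ₑ ^ 2 ≤ A * ∫⁻ s, K (t - s) * G s := by
    intro t ht
    have hsub : Ioc 0 t ⊆ Ioc 0 T := Ioc_subset_Ioc_right ht.2
    have hkm := (aestronglyMeasurable_comp_sub_left ht.2 hk).enorm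
    have e : ∀ x : ENNReal, (x ^ (1 / 2 : ℝ)) ^ 2 = x := fun x => by
      rw [← ENNReal.rpow_natCast, ← ENNReal.rpow_mul]; norm_num
    calc ‖causalConv k g t‖ₑ ^ 2
        ≤ (∫⁻ s in Ioc 0 t, ‖k (t - s)‖ₑ * ‖g s‖ₑ) ^ 2 := by
          gcongr; exact enorm_causalConv_le k g ht.1.le
      _ = (∫⁻ s in Ioc 0 t, ‖k (t - s)‖ₑ ^ (1 / 2 : ℝ)
            * (‖k (t - s)‖ₑ ^ (1 / 2 : ℝ) * ‖g s‖ₑ)) ^ 2 := by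
          simp only [← mul_assoc, ← pow_two, e]
      _ ≤ (∫⁻ s in Ioc 0 t, ‖k (t - s)‖ₑ) * ∫⁻ s in Ioc 0 t, ‖k (t - s)‖ₑ * ‖g s‖ₑ ^ 2 := by
          refine (ENNReal.sq_lintegral_mul_le _ (hkm.pow_const _)
            ((hkm.pow_const _).mul (hg.mono_set hsub).enorm)).trans_eq ?_
          simp only [Pi.mul_apply, mul_pow, e]
      _ ≤ A * ∫⁻ s, K (t - s) * G s := by
          refine mul_le_mul' ?_ ?_
          · exact lintegral_comp_sub_left_Ioc_le (F := fun s => ‖k s‖ₑ) ht.2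
          · rw [← restrict_Ioo_eq_restrict_Ioc, ← lintegral_indicator measurableSet_Ioo]
            refine lintegral_mono fun s => ?_
            by_cases hs : s ∈ Ioo 0 t
            · have h1 : t - s ∈ Ioc 0 T := ⟨by linarith [hs.2], by linarith [hs.1, ht.2]⟩
              have h2 : s ∈ Ioc 0 T := ⟨hs.1, by linarith [hs.2, ht.2]⟩
              simp [hs, hK, hG, h1, h2]
            · simp [hs]
  have hKG : AEMeasurable (fun p : ℝ × ℝ => K (p.1 - p.2) * G p.2) (volume.prod volume) :=
    (hKm.comp_quasiMeasurePreserving (quasiMeasurePreserving_sub volume volume)).mul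
      (hGm.comp_quasiMeasurePreserving Measure.quasiMeasurePreserving_snd)
  calc ∫⁻ t in Ioc 0 T, ‖causalConv k g t‖ₑ ^ 2
      ≤ ∫⁻ t in Ioc 0 T, A * ∫⁻ s, K (t - s) * G s :=
        setLIntegral_mono_ae' measurableSet_Ioc (.of_forall hpt)
    _ ≤ ∫⁻ t, A * ∫⁻ s, K (t - s) * G s := setLIntegral_le_lintegral _ _
    _ = A * ∫⁻ t, ∫⁻ s, K (t - s) * G s := lintegral_const_mul'' _ hKG.lintegral_prod_right'
    _ = A * ∫⁻ s, ∫⁻ t, K (t - s) * G s := by rw [lintegral_lintegral_swap hKG]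
    _ = A * ∫⁻ s, (∫⁻ t, K t) * G s := by
        congr 1
        refine lintegral_congr fun s => ?_
        have hm : AEMeasurable (fun t => K (t - s)) volume := hKm.comp_quasiMeasurePreserving
          (measurePreserving_sub_right volume s).quasiMeasurePreserving
        rw [lintegral_mul_const'' _ hm, lintegral_sub_right_eq_self K s]
    _ = A ^ 2 * ∫⁻ s in Ioc 0 T, ‖g s‖ₑ ^ 2 := by
        rw [lintegral_const_mul'' _ hGm, lintegral_indicator measurableSet_Ioc,
          lintegral_indicator measurableSet_Ioc, ← hA, pow_two, mul_assoc]

end CausalConvolution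

/-! ### Mittag-Leffler functions and kernels: series, recursion, fractional integration. -/

section MittagLeffler

open Set Filter Topology

/-- Log-convexity of Γ at x + 1 = a(x+a) + (1-a)(x+a+1). It makes Γ(x)/Γ(x+α) decay like x^(-α),
which feeds the ratio test for the Mittag-Leffler series. -/
theorem Real.mul_Gamma_le_rpow_mul_Gamma_add {x a : ℝ} (hx : 0 < x) (ha : 0 < a) (ha1 : a < 1) :
    x * Real.Gamma x ≤ (x + a) ^ (1 - a) * Real.Gamma (x + a) := by
  have hxa : 0 < x + a := by positivity
  have h := Real.Gamma_mul_add_mul_le_rpow_Gamma_mul_rpow_Gamma hxa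
    (by positivity : 0 < x + a + 1) ha (sub_pos.2 ha1) (by ring)
  have e : a * (x + a) + (1 - a) * (x + a + 1) = x + 1 := by ring
  have hG := Real.Gamma_pos_of_pos hxa
  rw [e, Real.Gamma_add_one hx.ne', Real.Gamma_add_one hxa.ne',
    Real.mul_rpow hxa.le hG.le] at h
  calc x * Real.Gamma x ≤ _ := h
    _ = (x + a) ^ (1 - a) * (Real.Gamma (x + a) ^ a * Real.Gamma (x + a) ^ (1 - a)) := by ring
    _ = _ := by rw [← Real.rpow_add hG]; simp

theorem summable_mittagLeffler {α β : ℝ} (hα : 0 < α) (hα1 : α < 1) (hβ : 0 < β) (z : ℝ) :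
    Summable fun m : ℕ => z ^ m / Real.Gamma (α * m + β) := by
  have hx : Tendsto (fun m : ℕ => α * (m : ℝ) + β) atTop atTop :=
    tendsto_atTop_add_const_right _ _ (tendsto_natCast_atTop_atTop.const_mul_atTop hα)
  have hlim : Tendsto (fun m : ℕ => |z| * 2 * (α * (m : ℝ) + β) ^ (-α)) atTop (𝓝 0) := by
    simpa using ((tendsto_rpow_neg_atTop hα).comp hx).const_mul (|z| * 2)
  refine summable_of_ratio_norm_eventually_le (r := 1 / 2) (by norm_num) ?_
  filter_upwards [hlim.eventually (ge_mem_nhds (by norm_num : (0 : ℝ) < 1 / 2)),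
    hx.eventually_ge_atTop α] with m hm hma
  set x := α * (m : ℝ) + β with hxdef
  have hx0 : 0 < x := hα.trans_le hma
  have e : α * ((m + 1 : ℕ) : ℝ) + β = x + α := by push_cast; ring
  have hG := Real.Gamma_pos_of_pos hx0
  have hG' := Real.Gamma_pos_of_pos (add_pos hx0 hα)
  rw [e, norm_div, norm_div, norm_pow, norm_pow, Real.norm_eq_abs, Real.norm_eq_abs,
    Real.norm_eq_abs, abs_of_pos hG, abs_of_pos hG', pow_succ]
  have h1 := Real.mul_Gamma_le_rpow_mul_Gamma_add hx0 hα hα1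
  have h2 : (x + α) ^ (1 - α) ≤ 2 * x ^ (1 - α) := by
    calc (x + α) ^ (1 - α) ≤ (2 * x) ^ (1 - α) :=
          Real.rpow_le_rpow (by positivity) (by linarith) (by linarith)
      _ = 2 ^ (1 - α) * x ^ (1 - α) := Real.mul_rpow (by norm_num) hx0.le
      _ ≤ 2 ^ (1 : ℝ) * x ^ (1 - α) := by
          gcongr
          · norm_num
          · linarith
      _ = _ := by simp
  have h3 : x ^ (1 - α) = x * x ^ (-α) := by
    rw [sub_eq_add_neg, Real.rpow_add hx0, Real.rpow_one]
  have h4 : Real.Gamma x ≤ 2 * x ^ (-α) * Real.Gamma (x + α) := by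
    refine le_of_mul_le_mul_left ?_ hx0
    calc x * Real.Gamma x ≤ (x + α) ^ (1 - α) * Real.Gamma (x + α) := h1
      _ ≤ 2 * x ^ (1 - α) * Real.Gamma (x + α) := by gcongr
      _ = _ := by rw [h3]; ring
  rw [div_le_iff₀ hG']
  have h5 : |z| * Real.Gamma x ≤ 1 / 2 * Real.Gamma (x + α) := by
    calc |z| * Real.Gamma x ≤ |z| * (2 * x ^ (-α) * Real.Gamma (x + α)) := by gcongr
      _ = |z| * 2 * x ^ (-α) * Real.Gamma (x + α) := by ring
      _ ≤ _ := by gcongr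
  have h6 : |z| ≤ 1 / 2 * Real.Gamma (x + α) / Real.Gamma x := (le_div_iff₀ hG).2 h5
  calc |z| ^ m * |z| ≤ |z| ^ m * (1 / 2 * Real.Gamma (x + α) / Real.Gamma x) := by gcongr
    _ = _ := by ring

theorem continuous_mittagLeffler {α β : ℝ} (hα : 0 < α) (hα1 : α < 1) (hβ : 0 < β) :
    Continuous (mittagLeffler α β) := by
  rw [continuous_iff_continuousAt]
  intro z
  have hnhds : Icc (z - 1) (z + 1) ∈ 𝓝 z := Icc_mem_nhds (by linarith) (by linarith)
  refine ContinuousOn.continuousAt (s := Icc (z - 1) (z + 1)) ?_ hnhds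
  refine continuousOn_tsum (fun m => by fun_prop)
    (summable_mittagLeffler hα hα1 hβ (|z| + 1)) fun m x hx => ?_
  have hG := Real.Gamma_pos_of_pos (by positivity : 0 < α * (m : ℝ) + β)
  rw [norm_div, norm_pow, Real.norm_eq_abs, Real.norm_eq_abs, abs_of_pos hG]
  gcongr
  rw [abs_le]
  constructor <;> linarith [hx.1, hx.2, neg_abs_le z, le_abs_self z]

theorem mittagLeffler_zero (α β : ℝ) : mittagLeffler α β 0 = 1 / Real.Gamma β := by
  rw [mittagLeffler, tsum_eq_single 0 fun m hm => by simp [hm]]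
  simp

/-- The kernel `t ^ (β - 1) / Γ(β)` of the Riemann-Liouville integral of order `β`. -/
noncomputable def fracKernel (β t : ℝ) : ℝ := t ^ (β - 1) / Real.Gamma β

/-- The Mittag-Leffler kernel `t ^ (β - 1) E_{α,β}(-c t ^ α)`. -/
noncomputable def mlKernel (α β c t : ℝ) : ℝ := t ^ (β - 1) * mittagLeffler α β (-c * t ^ α)

theorem rlIntegral_eq_causalConv {X : Type*} [NormedAddCommGroup X] [NormedSpace ℝ X]
    (β : ℝ) (g : ℝ → X) (t : ℝ) : rlIntegral β g t = causalConv (fracKernel β) g t := by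
  rw [rlIntegral, causalConv, ← intervalIntegral.integral_smul]
  refine intervalIntegral.integral_congr fun s _ => ?_
  simp only [fracKernel, smul_smul]
  congr 1
  ring

theorem fracKernel_pos {β t : ℝ} (hβ : 0 < β) (ht : 0 < t) : 0 < fracKernel β t :=
  div_pos (Real.rpow_pos_of_pos ht _) (Real.Gamma_pos_of_pos hβ)

theorem fracKernel_nonneg {β t : ℝ} (hβ : 0 < β) (ht : 0 ≤ t) : 0 ≤ fracKernel β t :=
  div_nonneg (Real.rpow_nonneg ht _) (Real.Gamma_pos_of_pos hβ).le

theorem fracKernel_one (t : ℝ) : fracKernel 1 t = 1 := by simp [fracKernel]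

theorem integrableOn_fracKernel {β : ℝ} (hβ : 0 < β) {T : ℝ} :
    IntegrableOn (fracKernel β) (Ioc 0 T) := by
  rcases le_or_gt T 0 with hT | hT
  · simp [Ioc_eq_empty_of_le hT]
  · exact (intervalIntegrable_iff_integrableOn_Ioc_of_le hT.le).1
      ((intervalIntegral.intervalIntegrable_rpow' (by linarith)).div_const _)

/-- Euler's Beta integral scaled to [0,t], with the real identity read off from the complex one. -/
theorem causalConv_fracKernel_fracKernel {β γ t : ℝ} (hβ : 0 < β) (hγ : 0 < γ) (ht : 0 < t) :
    causalConv (fracKernel γ) (fracKernel β) t = fracKernel (β + γ) t := by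
  have h := Complex.betaIntegral_scaled β γ ht
  have hG := Complex.Gamma_mul_Gamma_eq_betaIntegral (s := β) (t := γ) (by simpa) (by simpa)
  have e : ∫ s in (0 : ℝ)..t, s ^ (β - 1) * (t - s) ^ (γ - 1)
      = t ^ (β + γ - 1) * (Real.Gamma β * Real.Gamma γ / Real.Gamma (β + γ)) := by
    have h1 : ∫ x in (0 : ℝ)..t, (x : ℂ) ^ ((β : ℂ) - 1) * ((t : ℂ) - x) ^ ((γ : ℂ) - 1)
        = ((∫ s in (0 : ℝ)..t, s ^ (β - 1) * (t - s) ^ (γ - 1) : ℝ) : ℂ) := by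
      rw [← intervalIntegral.integral_ofReal]
      refine intervalIntegral.integral_congr fun s hs => ?_
      rw [uIcc_of_le ht.le] at hs
      push_cast [Complex.ofReal_cpow hs.1, Complex.ofReal_cpow (sub_nonneg.2 hs.2)]
      rfl
    have hne : Complex.Gamma ((β : ℂ) + γ) ≠ 0 := by
      rw [← Complex.ofReal_add, Complex.Gamma_ofReal]
      exact_mod_cast (Real.Gamma_pos_of_pos (add_pos hβ hγ)).ne'
    have h2 : Complex.betaIntegral β γ
        = ((Real.Gamma β * Real.Gamma γ / Real.Gamma (β + γ) : ℝ) : ℂ) := by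
      rw [eq_comm, Complex.ofReal_div, Complex.ofReal_mul, ← Complex.Gamma_ofReal,
        ← Complex.Gamma_ofReal, ← Complex.Gamma_ofReal, hG, Complex.ofReal_add,
        mul_div_cancel_left₀ _ hne]
    rw [h1, h2] at h
    have h3 : (t : ℂ) ^ ((β : ℂ) + γ - 1) = ((t ^ (β + γ - 1) : ℝ) : ℂ) := by
      rw [Complex.ofReal_cpow ht.le]; push_cast; rfl
    rw [h3] at h
    exact_mod_cast h
  have hβ' := (Real.Gamma_pos_of_pos hβ).ne'
  have hγ' := (Real.Gamma_pos_of_pos hγ).ne'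
  have e2 : causalConv (fracKernel γ) (fracKernel β) t
      = (Real.Gamma β * Real.Gamma γ)⁻¹ * ∫ s in (0 : ℝ)..t, s ^ (β - 1) * (t - s) ^ (γ - 1) := by
    rw [causalConv, ← intervalIntegral.integral_const_mul]
    refine intervalIntegral.integral_congr fun s _ => ?_
    simp only [fracKernel, smul_eq_mul]
    field_simp
  rw [e2, e, fracKernel]
  field_simp

/-- A divergent integral has the default value 0, whereas the Beta integral is positive. -/
theorem intervalIntegrable_fracKernel_mul {β γ t : ℝ} (hβ : 0 < β) (hγ : 0 < γ) (ht : 0 < t) :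
    IntervalIntegrable (fun s => fracKernel γ (t - s) • fracKernel β s) volume 0 t := by
  by_contra h
  have h1 := intervalIntegral.integral_undef h
  have h2 := causalConv_fracKernel_fracKernel hβ hγ ht
  rw [causalConv, h1] at h2
  exact (fracKernel_pos (add_pos hβ hγ) ht).ne h2

theorem hasSum_mlKernel {α β : ℝ} (hα : 0 < α) (hα1 : α < 1) (hβ : 0 < β) (c : ℝ) {t : ℝ}
    (ht : 0 < t) :
    HasSum (fun m : ℕ => (-c) ^ m * fracKernel (α * m + β) t) (mlKernel α β c t) := by
  have h := (summable_mittagLeffler hα hα1 hβ (-c * t ^ α)).hasSum.mul_left (t ^ (β - 1))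
  refine h.congr_fun fun m => ?_
  rw [fracKernel, add_sub_assoc, Real.rpow_add ht, Real.rpow_mul ht.le, Real.rpow_natCast]
  ring

/-- The term m = 0 of the series is split off and the index of the rest is shifted. For β = α this
becomes the resolvent equation of k_α. -/
theorem mlKernel_recursion {α β : ℝ} (hα : 0 < α) (hα1 : α < 1) (hβ : 0 < β) (c : ℝ) {t : ℝ}
    (ht : 0 < t) : mlKernel α β c t = fracKernel β t - c * mlKernel α (β + α) c t := by
  have h1 := hasSum_mlKernel hα hα1 hβ c ht
  have h2 := (hasSum_mlKernel hα hα1 (add_pos hβ hα) c ht).mul_left (-c)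
  have h3 := (hasSum_nat_add_iff' 1).2 h1
  have h4 := h3.unique (h2.congr_fun fun m => by
    push_cast
    rw [pow_succ, show α * ((m : ℝ) + 1) + β = α * m + (β + α) by ring]
    ring)
  simp at h4
  linarith

theorem continuousOn_mlKernel {α β : ℝ} (hα : 0 < α) (hα1 : α < 1) (hβ : 0 < β) (c : ℝ) :
    ContinuousOn (mlKernel α β c) (Ioi 0) := by
  refine ContinuousOn.mul (fun t ht => ?_) ?_
  · exact (Real.continuousAt_rpow_const _ _ (Or.inl (ne_of_gt ht))).continuousWithinAt
  · exact ((continuous_mittagLeffler hα hα1 hβ).comp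
      (continuous_const.mul (Real.continuous_rpow_const hα.le))).continuousOn

/-- Crude bound by compactness, with a constant depending on c; it serves integrability only. The
bound uniform in c > 0 is `mlKernel_le_fracKernel`. -/
theorem exists_abs_mlKernel_le {α β : ℝ} (hα : 0 < α) (hα1 : α < 1) (hβ : 0 < β) (c T : ℝ) :
    ∃ C, ∀ t ∈ Ioc 0 T, |mlKernel α β c t| ≤ C * fracKernel β t := by
  have hc : Continuous fun t : ℝ => mittagLeffler α β (-c * t ^ α) :=
    (continuous_mittagLeffler hα hα1 hβ).comp
      (continuous_const.mul (Real.continuous_rpow_const hα.le))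
  obtain ⟨C, hC⟩ := (isCompact_Icc (a := 0) (b := T)).exists_bound_of_continuousOn hc.continuousOn
  refine ⟨C * Real.Gamma β, fun t ht => ?_⟩
  have hG := (Real.Gamma_pos_of_pos hβ).ne'
  have hp : 0 ≤ t ^ (β - 1) := Real.rpow_nonneg ht.1.le _
  rw [mlKernel, abs_mul, abs_of_nonneg hp, fracKernel]
  calc _ ≤ t ^ (β - 1) * C := by gcongr; exact hC t ⟨ht.1.le, ht.2⟩
    _ = _ := by field_simp

theorem aestronglyMeasurable_mlKernel {α β : ℝ} (hα : 0 < α) (hα1 : α < 1) (hβ : 0 < β) (c T : ℝ) :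
    AEStronglyMeasurable (mlKernel α β c) (volume.restrict (Ioc 0 T)) :=
  ((continuousOn_mlKernel hα hα1 hβ c).mono Ioc_subset_Ioi_self).aestronglyMeasurable
    measurableSet_Ioc

theorem integrableOn_mlKernel {α β : ℝ} (hα : 0 < α) (hα1 : α < 1) (hβ : 0 < β) (c : ℝ) {T : ℝ} :
    IntegrableOn (mlKernel α β c) (Ioc 0 T) := by
  obtain ⟨C, hC⟩ := exists_abs_mlKernel_le hα hα1 hβ c T
  refine ((integrableOn_fracKernel hβ).const_mul C).mono'
    (aestronglyMeasurable_mlKernel hα hα1 hβ c T) ?_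
  filter_upwards [ae_restrict_mem measurableSet_Ioc] with t ht using hC t ht

theorem aestronglyMeasurable_fracKernel_sub {β t : ℝ} (hβ : 0 < β) :
    AEStronglyMeasurable (fun s => fracKernel β (t - s)) (volume.restrict (Ioc 0 t)) :=
  aestronglyMeasurable_comp_sub_left le_rfl (integrableOn_fracKernel hβ).1

theorem intervalIntegrable_fracKernel_mul_mlKernel {α β γ : ℝ} (hα : 0 < α) (hα1 : α < 1)
    (hβ : 0 < β) (hγ : 0 < γ) (c : ℝ) {t : ℝ} (ht : 0 < t) :
    IntervalIntegrable (fun s => fracKernel γ (t - s) • mlKernel α β c s) volume 0 t := by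
  obtain ⟨C, hC⟩ := exists_abs_mlKernel_le hα hα1 hβ c t
  have h := (intervalIntegrable_iff_integrableOn_Ioc_of_le ht.le).1
    (intervalIntegrable_fracKernel_mul hβ hγ ht)
  rw [intervalIntegrable_iff_integrableOn_Ioc_of_le ht.le]
  refine (h.const_mul C).mono' ((aestronglyMeasurable_fracKernel_sub hγ).smul
    (aestronglyMeasurable_mlKernel hα hα1 hβ c t)) ?_
  filter_upwards [ae_restrict_mem measurableSet_Ioc] with s hs
  have hp := fracKernel_nonneg hγ (sub_nonneg.2 hs.2)
  rw [norm_smul, Real.norm_of_nonneg hp, smul_eq_mul, mul_left_comm]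
  gcongr
  exact hC s hs

/-- Fractional integration of Mittag-Leffler kernels, `I^γ[t^(β-1) E_{α,β}(-c t^α)]
= t^(β+γ-1) E_{α,β+γ}(-c t^α)`. -/
theorem causalConv_fracKernel_mlKernel {α β γ : ℝ} (hα : 0 < α) (hα1 : α < 1)
    (hβ : 0 < β) (hγ : 0 < γ) (c : ℝ) {t : ℝ} (ht : 0 < t) :
    causalConv (fracKernel γ) (mlKernel α β c) t = mlKernel α (β + γ) c t := by
  have hβm : ∀ m : ℕ, 0 < α * (m : ℝ) + β := fun m => by positivity
  set F : ℕ → ℝ → ℝ := fun m s =>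
    (-c) ^ m * (fracKernel γ (t - s) • fracKernel (α * m + β) s) with hF
  have hint : ∀ m, Integrable (F m) (volume.restrict (Ioc 0 t)) := fun m =>
    ((intervalIntegrable_iff_integrableOn_Ioc_of_le ht.le).1
      (intervalIntegrable_fracKernel_mul (hβm m) hγ ht)).const_mul _
  -- The base `b` stays free because it is used with |c| for the norms and with -c for the series
  -- itself.
  have hval : ∀ (b : ℝ) (m : ℕ), ∫ s in Ioc 0 t, b ^ m *
      (fracKernel γ (t - s) • fracKernel (α * m + β) s)
        = b ^ m * fracKernel (α * m + (β + γ)) t := by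
    intro b m
    rw [integral_const_mul, ← intervalIntegral.integral_of_le ht.le, ← add_assoc,
      ← causalConv_fracKernel_fracKernel (hβm m) hγ ht, causalConv]
  have hnorm : ∀ m, ∫ s in Ioc 0 t, ‖F m s‖
      = |c| ^ m * fracKernel (α * m + (β + γ)) t := by
    intro m
    rw [← hval]
    refine setIntegral_congr_fun measurableSet_Ioc fun s hs => ?_
    have h1 := fracKernel_nonneg hγ (sub_nonneg.2 hs.2)
    have h2 := fracKernel_nonneg (hβm m) hs.1.le
    simp only [hF, norm_mul, norm_pow, norm_neg, Real.norm_eq_abs, smul_eq_mul,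
      abs_of_nonneg h1, abs_of_nonneg h2]
  -- The L¹ norms of the terms sum to the convergent series of the kernel with parameter -|c|, which
  -- justifies termwise integration.
  have hsum : Summable fun m => ∫ s in Ioc 0 t, ‖F m s‖ := by
    simp only [hnorm]
    simpa using (hasSum_mlKernel hα hα1 (add_pos hβ hγ) (-|c|) ht).summable
  have h := hasSum_integral_of_summable_integral_norm hint hsum
  have h1 : ∀ m, ∫ s in Ioc 0 t, F m s = (-c) ^ m * fracKernel (α * m + (β + γ)) t :=
    fun m => hval (-c) m
  simp only [h1] at h
  rw [(hasSum_mlKernel hα hα1 (add_pos hβ hγ) c ht).unique h, causalConv,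
    intervalIntegral.integral_of_le ht.le]
  refine setIntegral_congr_fun measurableSet_Ioc fun s hs => ?_
  have h2 := (hasSum_mlKernel hα hα1 hβ c hs.1).mul_left (fracKernel γ (t - s))
  simp only [smul_eq_mul]
  rw [← h2.tsum_eq]
  refine tsum_congr fun m => ?_
  simp only [hF, smul_eq_mul]
  ring

end MittagLeffler

/-! ### Positivity of the resolvent kernel and bounds uniform in the parameter. -/

section MittagLefflerSign

open Set Filter Topology

/-- Since t(t₀-s) ≥ t₀(t-s) and the exponent α-1 is negative. This is the consequence of
log-convexity of k_α that the positivity proof uses. -/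
theorem fracKernel_sub_le {α s t t₀ : ℝ} (hα : 0 < α) (hα1 : α < 1) (hs : 0 < s) (hst : s < t)
    (htt : t ≤ t₀) :
    fracKernel α (t₀ - s) ≤ fracKernel α t₀ / fracKernel α t * fracKernel α (t - s) := by
  have ht : 0 < t := hs.trans hst
  have ht₀ : 0 < t₀ := ht.trans_le htt
  rw [div_mul_eq_mul_div, le_div_iff₀ (fracKernel_pos hα ht)]
  simp only [fracKernel, div_mul_div_comm]
  have h1 : 0 ≤ t₀ - s := by linarith
  have h2 : 0 ≤ t - s := by linarith
  rw [← Real.mul_rpow h1 ht.le, ← Real.mul_rpow ht₀.le h2]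
  have hG := Real.Gamma_pos_of_pos hα
  refine div_le_div_of_nonneg_right ?_ (by positivity)
  exact Real.rpow_le_rpow_of_nonpos (mul_pos ht₀ (by linarith)) (by nlinarith) (by linarith)

theorem half_le_fracKernel_div {α t t₀ : ℝ} (hα : 0 < α) (ht : 0 < t)
    (h1 : t₀ / 2 ≤ t) (h2 : t ≤ t₀) : 1 / 2 ≤ fracKernel α t₀ / fracKernel α t := by
  have ht₀ : 0 < t₀ := ht.trans_le h2
  have hG := Real.Gamma_pos_of_pos hα
  have e : fracKernel α t₀ / fracKernel α t = (t / t₀) ^ (1 - α) := by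
    rw [fracKernel, fracKernel, div_div_div_cancel_right₀ hG.ne', ← Real.div_rpow ht₀.le ht.le,
      ← inv_div t t₀, Real.inv_rpow (by positivity), ← Real.rpow_neg (by positivity), neg_sub]
  rw [e]
  have h3 : t / t₀ ≤ 1 := (div_le_one ht₀).2 h2
  calc (1 / 2 : ℝ) ≤ t / t₀ := by rw [le_div_iff₀ ht₀]; linarith
    _ = (t / t₀) ^ (1 : ℝ) := (Real.rpow_one _).symm
    _ ≤ _ := Real.rpow_le_rpow_of_exponent_ge (by positivity) h3 (by linarith)

theorem integral_fracKernel_sub {α t t₀ : ℝ} (hα : 0 < α) :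
    ∫ s in t..t₀, fracKernel α (t₀ - s) = fracKernel (α + 1) (t₀ - t) := by
  rw [intervalIntegral.integral_comp_sub_left (fracKernel α) t₀, sub_self]
  simp only [fracKernel]
  rw [intervalIntegral.integral_div, integral_rpow (Or.inl (by linarith)), sub_add_cancel,
    Real.zero_rpow hα.ne', Real.Gamma_add_one hα.ne', add_sub_cancel_right]
  field_simp
  ring

/-- The kernel `t ^ (α - 1) E_{α,α}(-c t ^ α)`, the resolvent of a log-convex kernel, is
positive. -/
theorem mlKernel_pos {α c : ℝ} (hα : 0 < α) (hα1 : α < 1) (hc : 0 < c) {t : ℝ} (ht : 0 < t) :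
    0 < mlKernel α α c t := by
  by_contra hneg
  set e := mlKernel α α c with he
  -- q has the sign of e on t > 0 but is continuous up to 0 with q(0) > 0, so a first point t₀ > 0
  -- with q ≤ 0 exists.
  set q : ℝ → ℝ := fun t => mittagLeffler α α (-c * t ^ α) with hq
  have hqc : Continuous q := (continuous_mittagLeffler hα hα1 hα).comp
      (continuous_const.mul (Real.continuous_rpow_const hα.le))
  have hsign : ∀ s, 0 < s → (0 < e s ↔ 0 < q s) := fun s hs =>
    mul_pos_iff_of_pos_left (Real.rpow_pos_of_pos hs _)
  have hK : IsCompact (Icc 0 t ∩ q ⁻¹' Iic 0) :=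
    isCompact_Icc.inter_right (isClosed_Iic.preimage hqc)
  obtain ⟨t₀, ⟨⟨ht00, ht0t⟩, hqt0⟩, hleast⟩ := hK.exists_isLeast
    ⟨t, ⟨ht.le, le_rfl⟩, not_lt.1 fun h => hneg ((hsign t ht).2 h)⟩
  have hq0 : 0 < q 0 := by
    simp only [hq, Real.zero_rpow hα.ne', mul_zero, mittagLeffler_zero]
    exact one_div_pos.2 (Real.Gamma_pos_of_pos hα)
  have ht0 : 0 < t₀ := ht00.lt_of_ne fun h => by
    rw [← h] at hqt0; exact absurd hq0 (not_lt.2 hqt0)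
  have hepos : ∀ s, 0 < s → s < t₀ → 0 < e s := fun s hs hst => by
    refine (hsign s hs).2 (not_le.1 fun h => ?_)
    exact absurd (hleast ⟨⟨hs.le, (hst.trans_le ht0t).le⟩, h⟩) (not_le.2 hst)
  have het0 : e t₀ ≤ 0 := not_lt.1 fun h => absurd ((hsign t₀ ht0).1 h) (not_lt.2 hqt0)
  -- On the short window [t₀-δ, t₀] the memory term is at most c k_{α+1}(δ) < 1/2 times the maximum
  -- of e there; δ ≤ t₀/2 keeps the ratio k(t₀)/k(r) at least 1/2.
  obtain ⟨δ, hδ0, hδ1, hδ2⟩ : ∃ δ, 0 < δ ∧ δ ≤ t₀ / 2 ∧ c * fracKernel (α + 1) δ < 1 / 2 := by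
    have hcont : ContinuousAt (fun δ => c * fracKernel (α + 1) δ) 0 := by
      simp only [fracKernel, add_sub_cancel_right]
      exact continuousAt_const.mul ((Real.continuousAt_rpow_const _ _ (Or.inr hα.le)).div_const _)
    have h0 : c * fracKernel (α + 1) 0 < 1 / 2 := by
      simp [fracKernel, Real.zero_rpow hα.ne']
    have h1 : ∀ᶠ δ in 𝓝[>] (0 : ℝ), c * fracKernel (α + 1) δ < 1 / 2 :=
      (hcont.eventually (gt_mem_nhds h0)).filter_mono nhdsWithin_le_nhds
    have h2 : ∀ᶠ δ in 𝓝[>] (0 : ℝ), δ ∈ Ioc 0 (t₀ / 2) := Ioc_mem_nhdsGT (by positivity)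
    obtain ⟨δ, hδ, hδ'⟩ := (h1.and h2).exists
    exact ⟨δ, hδ'.1, hδ'.2, hδ⟩
  -- The equation at t₀ is compared with the equation at the maximum point r of e in the window. The
  -- memory up to r costs at most ρ (k * e)(r), the memory from r to t₀ at most k_{α+1}(δ) e(r).
  obtain ⟨r, hr, hmax⟩ := (isCompact_Icc (a := t₀ - δ) (b := t₀)).exists_isMaxOn
    ⟨t₀ - δ, le_rfl, by linarith⟩ ((continuousOn_mlKernel hα hα1 hα c).mono
      fun s hs => show 0 < s by linarith [hs.1])
  have her : 0 < e r := (hepos (t₀ - δ) (by linarith) (by linarith)).trans_le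
    (hmax ⟨le_rfl, by linarith⟩)
  have hr0 : 0 < r := by linarith [hr.1]
  have hrt : r ≤ t₀ := hr.2
  have hvolt : ∀ s, 0 < s → e s = fracKernel α s - c * causalConv (fracKernel α) e s :=
    fun s hs => by rw [causalConv_fracKernel_mlKernel hα hα1 hα hα c hs]
                   exact mlKernel_recursion hα hα1 hα c hs
  have hi0 := intervalIntegrable_fracKernel_mul_mlKernel hα hα1 hα hα c ht0
  have hir := intervalIntegrable_fracKernel_mul_mlKernel hα hα1 hα hα c hr0
  have hsub1 : uIcc 0 r ⊆ uIcc 0 t₀ := by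
    rw [uIcc_of_le hr0.le, uIcc_of_le ht0.le]; exact Icc_subset_Icc le_rfl hrt
  have hsub2 : uIcc r t₀ ⊆ uIcc 0 t₀ := by
    rw [uIcc_of_le hrt, uIcc_of_le ht0.le]; exact Icc_subset_Icc hr0.le le_rfl
  have hi1 := hi0.mono_set hsub1
  have hi2 := hi0.mono_set hsub2
  have hsplit : causalConv (fracKernel α) e t₀
      = (∫ s in (0 : ℝ)..r, fracKernel α (t₀ - s) • e s)
        + ∫ s in r..t₀, fracKernel α (t₀ - s) • e s :=
    (intervalIntegral.integral_add_adjacent_intervals hi1 hi2).symm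
  set ρ := fracKernel α t₀ / fracKernel α r with hρ
  have hA : (∫ s in (0 : ℝ)..r, fracKernel α (t₀ - s) • e s)
      ≤ ρ * causalConv (fracKernel α) e r := by
    rw [causalConv, ← intervalIntegral.integral_const_mul]
    refine intervalIntegral.integral_mono_on_of_le_Ioo hr0.le hi1 (hir.const_mul ρ) fun s hs => ?_
    have h1 := fracKernel_sub_le hα hα1 hs.1 hs.2 hrt
    have h2 := hepos s hs.1 (hs.2.trans_le hrt)
    simp only [smul_eq_mul]
    rw [← mul_assoc]
    gcongr
  have hB : (∫ s in r..t₀, fracKernel α (t₀ - s) • e s) ≤ fracKernel (α + 1) δ * e r := by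
    have hik : IntervalIntegrable (fun s => fracKernel α (t₀ - s)) volume r t₀ := by
      have h := (intervalIntegral.intervalIntegrable_rpow' (a := 0) (b := t₀ - r)
        (by linarith : -1 < α - 1)).div_const (Real.Gamma α)
      simpa [fracKernel] using (h.comp_sub_left t₀).symm
    calc (∫ s in r..t₀, fracKernel α (t₀ - s) • e s)
        ≤ ∫ s in r..t₀, fracKernel α (t₀ - s) * e r := by
          refine intervalIntegral.integral_mono_on_of_le_Ioo hrt hi2 (hik.mul_const _)
            fun s hs => ?_
          have h1 := fracKernel_nonneg hα (sub_nonneg.2 hs.2.le)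
          simp only [smul_eq_mul]
          gcongr
          exact hmax ⟨hr.1.trans hs.1.le, hs.2.le⟩
      _ = fracKernel (α + 1) (t₀ - r) * e r := by
          rw [intervalIntegral.integral_mul_const, integral_fracKernel_sub hα]
      _ ≤ _ := by
          have hG := Real.Gamma_pos_of_pos (by positivity : 0 < α + 1)
          simp only [fracKernel, add_sub_cancel_right]
          gcongr
          linarith [hr.1]
  have hhalf : 1 / 2 ≤ ρ := half_le_fracKernel_div hα hr0 (by linarith [hr.1]) hrt
  have hkr := fracKernel_pos hα hr0
  have hρk : ρ * fracKernel α r = fracKernel α t₀ := div_mul_cancel₀ _ hkr.ne'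
  have v0 := hvolt t₀ ht0
  have vr := hvolt r hr0
  rw [hsplit] at v0
  have hcc : c * causalConv (fracKernel α) e r = fracKernel α r - e r := by linarith
  -- With the equation at r the terms k(t₀) cancel, leaving e(t₀) ≥ (ρ - c k_{α+1}(δ)) e(r) > 0,
  -- contrary to the choice of t₀.
  have h1 : c * (ρ * causalConv (fracKernel α) e r) = fracKernel α t₀ - ρ * e r := by
    rw [mul_left_comm, hcc, mul_sub, hρk]
  have h2 := mul_le_mul_of_nonneg_left (add_le_add hA hB) hc.le
  have h3 : c * fracKernel (α + 1) δ * e r < ρ * e r :=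
    mul_lt_mul_of_pos_right (hδ2.trans_le hhalf) her
  linarith

theorem causalConv_nonneg {k g : ℝ → ℝ} {t : ℝ} (ht : 0 ≤ t) (hk : ∀ s, 0 ≤ s → 0 ≤ k s)
    (hg : ∀ s ∈ Ioc 0 t, 0 ≤ g s) : 0 ≤ causalConv k g t := by
  rw [causalConv, intervalIntegral.integral_of_le ht]
  exact setIntegral_nonneg measurableSet_Ioc fun s hs =>
    mul_nonneg (hk _ (sub_nonneg.2 hs.2)) (hg s hs)

theorem mlKernel_one_eq (α c t : ℝ) : mlKernel α 1 c t = mittagLeffler α 1 (-c * t ^ α) := by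
  simp [mlKernel]

theorem integral_mlKernel {α β c : ℝ} (hα : 0 < α) (hα1 : α < 1) (hβ : 0 < β) {t : ℝ}
    (ht : 0 < t) : ∫ s in (0 : ℝ)..t, mlKernel α β c s = mlKernel α (β + 1) c t := by
  rw [← causalConv_fracKernel_mlKernel hα hα1 hβ one_pos c ht, causalConv]
  simp [fracKernel_one]

theorem mlKernel_one_recursion {α c : ℝ} (hα : 0 < α) (hα1 : α < 1) {t : ℝ} (ht : 0 < t) :
    mlKernel α 1 c t = 1 - c * mlKernel α (α + 1) c t := by
  rw [mlKernel_recursion hα hα1 one_pos c ht, fracKernel_one, add_comm]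

theorem mlKernel_le_fracKernel {α c : ℝ} (hα : 0 < α) (hα1 : α < 1) (hc : 0 < c) {t : ℝ}
    (ht : 0 < t) : mlKernel α α c t ≤ fracKernel α t := by
  rw [mlKernel_recursion hα hα1 hα c ht, ← causalConv_fracKernel_mlKernel hα hα1 hα hα c ht]
  have h : 0 ≤ causalConv (fracKernel α) (mlKernel α α c) t :=
    causalConv_nonneg ht.le (fun s hs => fracKernel_nonneg hα hs)
      fun s hs => (mlKernel_pos hα hα1 hc hs.1).le
  linarith [mul_nonneg hc.le h]

/-- Both bounds come from e_c > 0: the function is the fractional integral of e_c of order 1-α, and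
it is also 1 - c ∫ e_c. -/
theorem mittagLeffler_one_mem_Icc {α c : ℝ} (hα : 0 < α) (hα1 : α < 1) (hc : 0 < c) {t : ℝ}
    (ht : 0 ≤ t) : mittagLeffler α 1 (-c * t ^ α) ∈ Icc 0 1 := by
  rcases ht.eq_or_lt with rfl | ht
  · simp [Real.zero_rpow hα.ne', mittagLeffler_zero]
  rw [← mlKernel_one_eq]
  constructor
  · have h := causalConv_fracKernel_mlKernel hα hα1 hα (sub_pos.2 hα1) c ht
    rw [add_sub_cancel] at h
    rw [← h]
    exact causalConv_nonneg ht.le (fun s hs => fracKernel_nonneg (sub_pos.2 hα1) hs)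
      fun s hs => (mlKernel_pos hα hα1 hc hs.1).le
  · rw [mlKernel_one_recursion hα hα1 ht, ← integral_mlKernel hα hα1 hα ht]
    have h : 0 ≤ ∫ s in (0 : ℝ)..t, mlKernel α α c s := by
      rw [intervalIntegral.integral_of_le ht.le]
      exact setIntegral_nonneg measurableSet_Ioc fun s hs => (mlKernel_pos hα hα1 hc hs.1).le
    linarith [mul_nonneg hc.le h]

/-- c ∫ e_c = 1 - E_{α,1}(-c T^α). Unlike the bound e_c ≤ k_α, this does not deteriorate as c grows.
-/
theorem mul_lintegral_mlKernel_le_one {α c : ℝ} (hα : 0 < α) (hα1 : α < 1) (hc : 0 < c) {T : ℝ}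
    (hT : 0 < T) :
    ENNReal.ofReal c * ∫⁻ s in Ioc 0 T, ‖mlKernel α α c s‖ₑ ≤ 1 := by
  have h1 : ∫⁻ s in Ioc 0 T, ‖mlKernel α α c s‖ₑ
      = ENNReal.ofReal (∫ s in Ioc 0 T, mlKernel α α c s) := by
    rw [ofReal_integral_eq_lintegral_ofReal (integrableOn_mlKernel hα hα1 hα c)]
    · refine setLIntegral_congr_fun measurableSet_Ioc fun s hs => ?_
      exact Real.enorm_of_nonneg (mlKernel_pos hα hα1 hc hs.1).le
    · filter_upwards [ae_restrict_mem measurableSet_Ioc] with s hs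
      exact (mlKernel_pos hα hα1 hc hs.1).le
  rw [h1, ← ENNReal.ofReal_mul hc.le, ← intervalIntegral.integral_of_le hT.le,
    integral_mlKernel hα hα1 hα hT]
  have h2 := mlKernel_one_recursion (c := c) hα hα1 hT
  have h3 := (mittagLeffler_one_mem_Icc hα hα1 hc hT.le).1
  rw [← mlKernel_one_eq] at h3
  exact ENNReal.ofReal_le_one.2 (by linarith)

end MittagLefflerSign

/-! ### The fractional relaxation equation: existence and uniqueness. -/

section ScalarCaputo

open Set Filter Topology

variable {X : Type*} [NormedAddCommGroup X] [NormedSpace ℝ X]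

theorem causalConv_add_right_ae {k : ℝ → ℝ} {g h : ℝ → X} {T : ℝ}
    (hk : IntegrableOn k (Ioc 0 T)) (hg : IntegrableOn g (Ioc 0 T))
    (hh : IntegrableOn h (Ioc 0 T)) :
    ∀ᵐ t ∂volume.restrict (Ioc 0 T),
      causalConv k (fun s => g s + h s) t = causalConv k g t + causalConv k h t := by
  filter_upwards [causalConv_integrand_ae hk hg, causalConv_integrand_ae hk hh] with t h1 h2
  simp only [causalConv, smul_add]
  exact intervalIntegral.integral_add h1 h2

theorem causalConv_sub_right_ae {k : ℝ → ℝ} {g h : ℝ → X} {T : ℝ}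
    (hk : IntegrableOn k (Ioc 0 T)) (hg : IntegrableOn g (Ioc 0 T))
    (hh : IntegrableOn h (Ioc 0 T)) :
    ∀ᵐ t ∂volume.restrict (Ioc 0 T),
      causalConv k (fun s => g s - h s) t = causalConv k g t - causalConv k h t := by
  filter_upwards [causalConv_integrand_ae hk hg, causalConv_integrand_ae hk hh] with t h1 h2
  simp only [causalConv, smul_sub]
  exact intervalIntegral.integral_sub h1 h2

theorem causalConv_sub_left_ae {k l : ℝ → ℝ} {g : ℝ → X} {T : ℝ}
    (hk : IntegrableOn k (Ioc 0 T)) (hl : IntegrableOn l (Ioc 0 T))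
    (hg : IntegrableOn g (Ioc 0 T)) :
    ∀ᵐ t ∂volume.restrict (Ioc 0 T),
      causalConv (fun s => k s - l s) g t = causalConv k g t - causalConv l g t := by
  filter_upwards [causalConv_integrand_ae hk hg, causalConv_integrand_ae hl hg] with t h1 h2
  simp only [causalConv, sub_smul]
  exact intervalIntegral.integral_sub h1 h2

theorem causalConv_const_mul_left (c : ℝ) (k : ℝ → ℝ) (g : ℝ → X) (t : ℝ) :
    causalConv (fun s => c * k s) g t = c • causalConv k g t := by
  simp only [causalConv, mul_smul, intervalIntegral.integral_smul]

theorem causalConv_const_smul_right (c : ℝ) (k : ℝ → ℝ) (g : ℝ → X) (t : ℝ) :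
    causalConv k (fun s => c • g s) t = c • causalConv k g t := by
  simp only [causalConv, smul_comm _ c, intervalIntegral.integral_smul]

theorem causalConv_smul_const [CompleteSpace X] (k l : ℝ → ℝ) (x : X) (t : ℝ) :
    causalConv k (fun s => l s • x) t = causalConv k l t • x := by
  simp only [causalConv, smul_smul, intervalIntegral.integral_smul_const, smul_eq_mul]

theorem integrableOn_one {T : ℝ} : IntegrableOn (fun _ => (1 : ℝ)) (Ioc 0 T) :=
  integrableOn_const (by simp)

theorem intervalIntegrable_of_mem {X : Type*} [NormedAddCommGroup X] {g : ℝ → X} {t T : ℝ}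
    (hg : IntegrableOn g (Ioc 0 T))
    (ht : t ∈ Ioc 0 T) : IntervalIntegrable g volume 0 t :=
  (intervalIntegrable_iff_integrableOn_Ioc_of_le ht.1.le).2
    (hg.mono_set (Ioc_subset_Ioc_right ht.2))

theorem HasCaputoDeriv.congr_ae {α T : ℝ} {g g' v v' : ℝ → X} (h : HasCaputoDeriv α T g v)
    (hg : g =ᵐ[volume.restrict (Ioc 0 T)] g') (h0 : g 0 = g' 0)
    (hv : v =ᵐ[volume.restrict (Ioc 0 T)] v') : HasCaputoDeriv α T g' v' := by
  refine ⟨h.1.congr hg, h.2.1.congr hv, ?_⟩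
  filter_upwards [h.2.2, ae_restrict_mem measurableSet_Ioc] with t h1 ht
  have e1 : rlIntegral (1 - α) (fun s => g s - g 0) t
      = rlIntegral (1 - α) (fun s => g' s - g' 0) t := by
    rw [rlIntegral_eq_causalConv, rlIntegral_eq_causalConv]
    refine causalConv_congr ⟨ht.1.le, ht.2⟩ (fun _ _ => rfl) ?_
    filter_upwards [hg] with s hs
    rw [hs, h0]
  have e2 : (∫ s in (0 : ℝ)..t, v s) = ∫ s in (0 : ℝ)..t, v' s := by
    rw [← causalConv_one, ← causalConv_one]
    exact causalConv_congr ⟨ht.1.le, ht.2⟩ (fun _ _ => rfl) hv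
  rw [← e1, ← e2, h1]

theorem HasCaputoDeriv.const_smul {α T : ℝ} {g v : ℝ → X} (h : HasCaputoDeriv α T g v) (c : ℝ) :
    HasCaputoDeriv α T (fun t => c • g t) (fun t => c • v t) := by
  refine ⟨h.1.smul c, h.2.1.smul c, ?_⟩
  filter_upwards [h.2.2] with t ht
  rw [rlIntegral_eq_causalConv] at ht ⊢
  rw [intervalIntegral.integral_smul, ← ht, ← causalConv_const_smul_right]
  simp only [smul_sub]

theorem HasCaputoDeriv.sub {α T : ℝ} (hα1 : α < 1) {g v g' v' : ℝ → X}
    (h : HasCaputoDeriv α T g v) (h' : HasCaputoDeriv α T g' v') :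
    HasCaputoDeriv α T (fun t => g t - g' t) (fun t => v t - v' t) := by
  have hc : ∀ x : X, IntegrableOn (fun _ => x) (Ioc 0 T) := fun x => integrableOn_const (by simp)
  refine ⟨h.1.sub h'.1, h.2.1.sub h'.2.1, ?_⟩
  filter_upwards [h.2.2, h'.2.2, ae_restrict_mem measurableSet_Ioc,
    causalConv_sub_right_ae (integrableOn_fracKernel (sub_pos.2 hα1)) (h.1.sub (hc (g 0)))
      (h'.1.sub (hc (g' 0)))] with t h1 h2 ht h3
  rw [rlIntegral_eq_causalConv] at h1 h2 ⊢
  rw [intervalIntegral.integral_sub (intervalIntegrable_of_mem h.2.1 ht)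
    (intervalIntegrable_of_mem h'.2.1 ht), ← h1, ← h2]
  simp only [Pi.sub_apply] at h3
  refine Eq.trans ?_ h3
  congr 1
  ext s
  abel

theorem causalConv_zero_time (k : ℝ → ℝ) (g : ℝ → X) : causalConv k g 0 = 0 := by
  simp [causalConv]

theorem causalConv_fracKernel_one {k : ℝ → ℝ} (t : ℝ) :
    causalConv (fracKernel 1) k t = causalConv (fun _ => 1) k t := by
  simp [causalConv, fracKernel_one]

theorem causalConv_one_mlKernel {α β c : ℝ} (hα : 0 < α) (hα1 : α < 1) (hβ : 0 < β) {t : ℝ}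
    (ht : 0 < t) : causalConv (fun _ => 1) (mlKernel α β c) t = mlKernel α (β + 1) c t := by
  rw [← causalConv_fracKernel_one, causalConv_fracKernel_mlKernel hα hα1 hβ one_pos c ht]

/-- Convolution with the Mittag-Leffler kernel `E_{α,1}(-c t^α) = 1 - c t^α E_{α,α+1}(-c t^α)`. -/
theorem causalConv_mlKernel_one_ae {α c T : ℝ} (hα : 0 < α) (hα1 : α < 1) {h : ℝ → X}
    (hh : IntegrableOn h (Ioc 0 T)) :
    ∀ᵐ t ∂volume.restrict (Ioc 0 T), causalConv (mlKernel α 1 c) h t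
      = (∫ s in (0 : ℝ)..t, h s) - c • causalConv (mlKernel α (α + 1) c) h t := by
  filter_upwards [causalConv_sub_left_ae integrableOn_one
    ((integrableOn_mlKernel hα hα1 (by positivity : 0 < α + 1) c).const_mul c) hh,
    ae_restrict_mem measurableSet_Ioc] with t h1 ht
  rw [← causalConv_one, ← causalConv_const_mul_left, ← h1]
  exact causalConv_congr ⟨ht.1.le, ht.2⟩
    (fun s hs => mlKernel_one_recursion hα hα1 hs.1) (.refl _ _)

/-- The variation of constants formula for the fractional relaxation equation
`D_t^α y = h - c y`, `y(0) = y₀`. -/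
theorem hasCaputoDeriv_relaxation [CompleteSpace X] {α c T : ℝ} (hα : 0 < α) (hα1 : α < 1) (y₀ : X)
    {h : ℝ → X} (hh : IntegrableOn h (Ioc 0 T)) {y : ℝ → X}
    (hy : ∀ t, y t = mittagLeffler α 1 (-c * t ^ α) • y₀ + causalConv (mlKernel α α c) h t) :
    HasCaputoDeriv α T y (fun t => h t - c • y t) := by
  have hγ : 0 < 1 - α := sub_pos.2 hα1
  have hk := integrableOn_fracKernel hγ (T := T)
  have he := integrableOn_mlKernel hα hα1 hα c (T := T)
  have hp := integrableOn_mlKernel hα hα1 one_pos c (T := T)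
  have hp1 := integrableOn_mlKernel hα hα1 (by positivity : 0 < α + 1) c (T := T)
  have heh := integrableOn_causalConv he hh
  have hpy : IntegrableOn (fun t => mlKernel α 1 c t • y₀) (Ioc 0 T) := hp.smul_const y₀
  have hy' : ∀ t, y t = mlKernel α 1 c t • y₀ + causalConv (mlKernel α α c) h t := fun t => by
    rw [hy, mlKernel_one_eq]
  have hy0 : y 0 = y₀ := by
    rw [hy, causalConv_zero_time, Real.zero_rpow hα.ne', mul_zero, mittagLeffler_zero]
    simp
  have hyi : IntegrableOn y (Ioc 0 T) := (hpy.add heh).congr (.of_forall fun t => (hy' t).symm)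
  refine ⟨hyi, hh.sub (hyi.smul c), ?_⟩
  have hfirst : IntegrableOn (fun t => (-c * mlKernel α (α + 1) c t) • y₀) (Ioc 0 T) :=
    (hp1.const_mul (-c)).smul_const y₀
  filter_upwards [ae_restrict_mem measurableSet_Ioc, causalConv_add_right_ae hk hfirst heh,
    causalConv_assoc hk he hh, causalConv_assoc integrableOn_one he hh,
    causalConv_mlKernel_one_ae (c := c) hα hα1 hh] with t ht h1 h2 h3 h4
  have htI : t ∈ Icc 0 T := ⟨ht.1.le, ht.2⟩
  -- Here y - y₀ = -c t^α E_{α,α+1}(-c t^α) y₀ + e_c * h, and I^(1-α) raises each second index by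
  -- 1-α. `e2` raises those of y by 1; the two sides then match by the recursion for E_{α,1}.
  have e1 : rlIntegral (1 - α) (fun s => y s - y 0) t
      = (-c * mlKernel α 2 c t) • y₀ + causalConv (mlKernel α 1 c) h t := by
    rw [rlIntegral_eq_causalConv]
    have a1 : causalConv (fracKernel (1 - α)) (fun s => y s - y 0) t
        = causalConv (fracKernel (1 - α)) (fun s => (-c * mlKernel α (α + 1) c s) • y₀
            + causalConv (mlKernel α α c) h s) t := by
      refine causalConv_congr htI (fun _ _ => rfl) ?_
      filter_upwards [ae_restrict_mem measurableSet_Ioc] with s hs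
      rw [hy0, hy', mlKernel_one_recursion hα hα1 hs.1]
      module
    have a2 : causalConv (causalConv (fracKernel (1 - α)) (mlKernel α α c)) h t
        = causalConv (mlKernel α 1 c) h t := by
      refine causalConv_congr htI (fun s hs => ?_) (.refl _ _)
      rw [causalConv_fracKernel_mlKernel hα hα1 hα hγ c hs.1, add_sub_cancel]
    rw [a1, h1, h2, a2, causalConv_smul_const]
    have a3 := causalConv_const_smul_right (-c) (fracKernel (1 - α)) (mlKernel α (α + 1) c) t
    simp only [smul_eq_mul] at a3
    rw [a3, causalConv_fracKernel_mlKernel hα hα1 (by positivity) hγ c ht.1,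
      show α + 1 + (1 - α) = 2 by ring]
  have e2 : ∫ s in (0 : ℝ)..t, y s
      = mlKernel α 2 c t • y₀ + causalConv (mlKernel α (α + 1) c) h t := by
    have b1 : ∫ s in (0 : ℝ)..t, y s = (∫ s in (0 : ℝ)..t, mlKernel α 1 c s • y₀)
        + ∫ s in (0 : ℝ)..t, causalConv (mlKernel α α c) h s := by
      simp only [hy']
      exact intervalIntegral.integral_add (intervalIntegrable_of_mem hpy ht)
        (intervalIntegrable_of_mem heh ht)
    rw [b1, intervalIntegral.integral_smul_const, integral_mlKernel hα hα1 one_pos ht.1,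
      ← causalConv_one (causalConv (mlKernel α α c) h), h3]
    congr 1
    · norm_num
    · exact causalConv_congr htI
        (fun s hs => causalConv_one_mlKernel hα hα1 hα hs.1) (.refl _ _)
  have e3 : ∫ s in (0 : ℝ)..t, (h s - c • y s)
      = (∫ s in (0 : ℝ)..t, h s) - ∫ s in (0 : ℝ)..t, c • y s :=
    intervalIntegral.integral_sub (intervalIntegrable_of_mem hh ht)
      ((intervalIntegrable_of_mem hyi ht).smul c)
  rw [e1, h4, e3, intervalIntegral.integral_smul, e2]
  module

/-- The primitive is continuous, hence zero throughout (0,T), and Lebesgue differentiation recovers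
y. -/
theorem ae_eq_zero_of_integral_eq_zero [CompleteSpace X] {y : ℝ → X} {T : ℝ}
    (hy : IntegrableOn y (Ioc 0 T))
    (h : ∀ᵐ t ∂volume.restrict (Ioc 0 T), ∫ s in (0 : ℝ)..t, y s = 0) :
    y =ᵐ[volume.restrict (Ioc 0 T)] 0 := by
  rcases le_or_gt T 0 with hT | hT
  · simp [Ioc_eq_empty_of_le hT, EventuallyEq]
  have hi := (intervalIntegrable_iff_integrableOn_Ioc_of_le hT.le).2 hy
  have hcont : ContinuousOn (fun t => ∫ s in (0 : ℝ)..t, y s) (Ioo 0 T) :=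
    (intervalIntegral.continuousOn_primitive_interval' hi left_mem_uIcc).mono
      (Ioo_subset_Icc_self.trans (Icc_subset_uIcc))
  have hzero : EqOn (fun t => ∫ s in (0 : ℝ)..t, y s) (fun _ => 0) (Ioo 0 T) :=
    Measure.eqOn_Ioo_of_ae_eq volume
      (ae_restrict_of_ae_restrict_of_subset Ioo_subset_Ioc_self h) hcont continuousOn_const
  rw [← restrict_Ioo_eq_restrict_Ioc]
  filter_upwards [ae_restrict_of_ae hi.ae_hasDerivAt_integral,
    ae_restrict_mem measurableSet_Ioo] with t h1 ht
  have h2 := h1 (Icc_subset_uIcc (Ioo_subset_Icc_self ht)) 0 left_mem_uIcc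
  have h3 : HasDerivAt (fun t => ∫ s in (0 : ℝ)..t, y s) 0 t :=
    (hasDerivAt_const t (0 : X)).congr_of_eventuallyEq
      (hzero.eventuallyEq_of_mem (Ioo_mem_nhds ht.1 ht.2))
  exact h2.unique h3

/-- Convolving k_{1-α} * y = -c (1 * y) with e_c gives p * y = -c (q * y), where p = E_{α,1}(-c t^α)
and q = `mlKernel α (α + 1) c`. As p + c q = 1, the primitive of y vanishes. -/
theorem ae_eq_zero_of_relaxation [CompleteSpace X] {α c T : ℝ} (hα : 0 < α) (hα1 : α < 1)
    {y : ℝ → X} (h0 : y 0 = 0) (h : HasCaputoDeriv α T y (fun t => -(c • y t))) :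
    y =ᵐ[volume.restrict (Ioc 0 T)] 0 := by
  have hγ : 0 < 1 - α := sub_pos.2 hα1
  have hk := integrableOn_fracKernel hγ (T := T)
  have he := integrableOn_mlKernel hα hα1 hα c (T := T)
  have hy := h.1
  refine ae_eq_zero_of_integral_eq_zero hy ?_
  have heq : causalConv (fracKernel (1 - α)) y
      =ᵐ[volume.restrict (Ioc 0 T)] fun t => (-c) • causalConv (fun _ => 1) y t := by
    filter_upwards [h.2.2] with t ht
    rw [rlIntegral_eq_causalConv] at ht
    simp only [h0, sub_zero] at ht
    rw [ht, causalConv_one, ← intervalIntegral.integral_smul]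
    simp
  filter_upwards [ae_restrict_mem measurableSet_Ioc, causalConv_assoc he hk hy,
    causalConv_assoc he integrableOn_one hy, causalConv_mlKernel_one_ae (c := c) hα hα1 hy]
    with t ht h1 h2 h3
  have htI : t ∈ Icc 0 T := ⟨ht.1.le, ht.2⟩
  have a1 : causalConv (causalConv (mlKernel α α c) (fracKernel (1 - α))) y t
      = causalConv (mlKernel α 1 c) y t := by
    refine causalConv_congr htI (fun s hs => ?_) (.refl _ _)
    rw [causalConv_comm, causalConv_fracKernel_mlKernel hα hα1 hα hγ c hs.1, add_sub_cancel]
  have a2 : causalConv (causalConv (mlKernel α α c) (fun _ => 1)) y t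
      = causalConv (mlKernel α (α + 1) c) y t := by
    refine causalConv_congr htI (fun s hs => ?_) (.refl _ _)
    rw [causalConv_comm, causalConv_one_mlKernel hα hα1 hα hs.1]
  have a3 := causalConv_congr htI (fun s _ => (rfl : mlKernel α α c s = _)) heq
  rw [h1, a1, h3, causalConv_const_smul_right, h2, a2, neg_smul, sub_eq_neg_self] at a3
  exact a3

/-- Uniqueness for the fractional relaxation equation. -/
theorem ae_eq_of_relaxation [CompleteSpace X] {α c T : ℝ} (hα : 0 < α) (hα1 : α < 1)
    {y w h : ℝ → X} (h0 : y 0 = w 0) (hy : HasCaputoDeriv α T y (fun t => h t - c • y t))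
    (hw : HasCaputoDeriv α T w (fun t => h t - c • w t)) :
    y =ᵐ[volume.restrict (Ioc 0 T)] w := by
  have hd := (hy.sub hα1 hw).congr_ae (.refl _ _) rfl (v' := fun t => -(c • (y t - w t)))
    (.of_forall fun t => by module)
  filter_upwards [ae_eq_zero_of_relaxation hα hα1 (by simp [h0]) hd] with t ht
  exact sub_eq_zero.1 ht

end ScalarCaputo

/-! ### Square summable families of L² functions. -/

section SquareSummableFamilies

open Set Filter Topology

variable {𝕜 ι : Type*} [RCLike 𝕜]

theorem memℓp_two_iff_tsum_enorm {a : ι → 𝕜} : Memℓp a 2 ↔ ∑' ξ, ‖a ξ‖ₑ ^ 2 ≠ ⊤ := by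
  rw [memℓp_gen_iff (by simp)]
  have : ∀ ξ, ‖a ξ‖ₑ ^ 2 = ((‖a ξ‖₊ ^ 2 : NNReal) : ENNReal) := fun ξ => by
    simp [enorm_eq_nnnorm]
  simp only [this]
  rw [ENNReal.tsum_coe_ne_top_iff_summable, ← NNReal.summable_coe]
  simp

theorem Memℓp.of_norm_le {a b : ι → 𝕜} (ha : Memℓp a 2) {C : ℝ}
    (h : ∀ ξ, ‖b ξ‖ ≤ C * ‖a ξ‖) : Memℓp b 2 := by
  rw [memℓp_gen_iff (by simp)] at ha ⊢
  refine Summable.of_nonneg_of_le (fun ξ => by positivity) (fun ξ => ?_) (ha.mul_left (C ^ 2))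
  simpa [mul_pow] using pow_le_pow_left₀ (norm_nonneg _) (h ξ) 2

theorem memLp_two_iff_lintegral {Ω E : Type*} [MeasurableSpace Ω] [NormedAddCommGroup E]
    {μ : Measure Ω} {g : Ω → E} :
    MemLp g 2 μ ↔ AEStronglyMeasurable g μ ∧ ∫⁻ t, ‖g t‖ₑ ^ 2 ∂μ < ⊤ := by
  refine and_congr_right fun _ => ?_
  rw [eLpNorm_lt_top_iff_lintegral_rpow_enorm_lt_top (by simp) (by simp)]
  simp

/-- A family of functions whose squared `L²` norms have a finite sum. -/
structure IsL2Family {Ω : Type*} [MeasurableSpace Ω] (μ : Measure Ω) (c : ι → Ω → 𝕜) : Prop where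
  aestronglyMeasurable : ∀ ξ, AEStronglyMeasurable (c ξ) μ
  tsum_ne_top : ∑' ξ, ∫⁻ t, ‖c ξ t‖ₑ ^ 2 ∂μ ≠ ⊤

namespace IsL2Family

variable {Ω : Type*} [MeasurableSpace Ω] {μ : Measure Ω} {c d : ι → Ω → 𝕜}

theorem memLp (hc : IsL2Family μ c) (ξ : ι) : MemLp (c ξ) 2 μ :=
  memLp_two_iff_lintegral.2 ⟨hc.1 ξ, (ENNReal.ne_top_of_tsum_ne_top hc.2 ξ).lt_top⟩

theorem integrable [IsFiniteMeasure μ] (hc : IsL2Family μ c) (ξ : ι) : Integrable (c ξ) μ :=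
  (hc.memLp ξ).integrable (by norm_num)

theorem add (hc : IsL2Family μ c) (hd : IsL2Family μ d) :
    IsL2Family μ (fun ξ t => c ξ t + d ξ t) := by
  refine ⟨fun ξ => (hc.1 ξ).add (hd.1 ξ), ne_top_of_le_ne_top
    (ENNReal.mul_ne_top (ENNReal.ofNat_ne_top (n := 2)) (ENNReal.add_ne_top.2 ⟨hc.2, hd.2⟩)) ?_⟩
  rw [← ENNReal.tsum_add, ← ENNReal.tsum_mul_left]
  refine ENNReal.tsum_le_tsum fun ξ => ?_
  rw [← lintegral_add_left' ((hc.1 ξ).enorm.pow_const 2),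
    ← lintegral_const_mul' _ _ ENNReal.ofNat_ne_top]
  refine lintegral_mono fun t => ?_
  have h := ENNReal.rpow_add_le_mul_rpow_add_rpow ‖c ξ t‖ₑ ‖d ξ t‖ₑ (p := 2) (by norm_num)
  norm_num at h
  exact (pow_le_pow_left' (enorm_add_le _ _) 2).trans h

theorem of_enorm_le (hc : IsL2Family μ c) (hd : ∀ ξ, AEStronglyMeasurable (d ξ) μ) {C : NNReal}
    (h : ∀ ξ, ∫⁻ t, ‖d ξ t‖ₑ ^ 2 ∂μ ≤ C * ∫⁻ t, ‖c ξ t‖ₑ ^ 2 ∂μ) : IsL2Family μ d := by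
  refine ⟨hd, ne_top_of_le_ne_top (ENNReal.mul_ne_top (ENNReal.coe_ne_top (r := C)) hc.2) ?_⟩
  rw [← ENNReal.tsum_mul_left]
  exact ENNReal.tsum_le_tsum h

theorem smul (hc : IsL2Family μ c) {b : ι → Ω → ℝ} (hb : ∀ ξ, AEStronglyMeasurable (b ξ) μ)
    {C : ℝ} (h : ∀ ξ, ∀ᵐ t ∂μ, |b ξ t| ≤ C) : IsL2Family μ (fun ξ t => b ξ t • c ξ t) := by
  refine hc.of_enorm_le (C := C.toNNReal ^ 2) (fun ξ => (hb ξ).smul (hc.1 ξ)) fun ξ => ?_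
  rw [← lintegral_const_mul'' _ ((hc.1 ξ).enorm.pow_const 2)]
  refine lintegral_mono_ae ?_
  filter_upwards [h ξ] with t ht
  rw [enorm_smul, mul_pow, ENNReal.coe_pow]
  gcongr
  rw [← ofReal_norm]
  exact ENNReal.ofReal_le_ofReal ht

theorem const_smul (hc : IsL2Family μ c) {b : ι → ℝ} {C : ℝ} (h : ∀ ξ, |b ξ| ≤ C) :
    IsL2Family μ (fun ξ t => b ξ • c ξ t) :=
  hc.smul (b := fun ξ _ => b ξ) (fun _ => aestronglyMeasurable_const)
    fun ξ => .of_forall fun _ => h ξ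

theorem const [IsFiniteMeasure μ] {a : ι → 𝕜} (ha : Memℓp a 2) :
    IsL2Family μ (fun ξ (_ : Ω) => a ξ) := by
  refine ⟨fun _ => aestronglyMeasurable_const, ?_⟩
  simp only [lintegral_const]
  rw [ENNReal.tsum_mul_right]
  exact ENNReal.mul_ne_top (memℓp_two_iff_tsum_enorm.1 ha) (measure_ne_top _ _)

/-- Tonelli: the sum of the integrals is the integral of the sum, so the sum is finite almost
everywhere. -/
theorem ae_memℓp [Countable ι] (hc : IsL2Family μ c) : ∀ᵐ t ∂μ, Memℓp (fun ξ => c ξ t) 2 := by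
  have hm : ∀ ξ, AEMeasurable (fun t => ‖c ξ t‖ₑ ^ 2) μ := fun ξ => (hc.1 ξ).enorm.pow_const 2
  have h : ∫⁻ t, ∑' ξ, ‖c ξ t‖ₑ ^ 2 ∂μ ≠ ⊤ := by rw [lintegral_tsum hm]; exact hc.2
  filter_upwards [ae_lt_top' (AEMeasurable.tsum hm) h] with t ht
  exact memℓp_two_iff_tsum_enorm.2 ht.ne

theorem causalConv {c : ι → ℝ → 𝕜} {T : ℝ} (hc : IsL2Family (volume.restrict (Ioc 0 T)) c)
    {k : ι → ℝ → ℝ} (hk : ∀ ξ, IntegrableOn (k ξ) (Ioc 0 T)) {B : NNReal}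
    (hB : ∀ ξ, ∫⁻ s in Ioc 0 T, ‖k ξ s‖ₑ ≤ B) :
    IsL2Family (volume.restrict (Ioc 0 T)) (fun ξ => causalConv (k ξ) (c ξ)) := by
  refine hc.of_enorm_le (C := B ^ 2)
    (fun ξ => (integrableOn_causalConv (hk ξ) (hc.integrable ξ)).1) fun ξ => ?_
  refine (lintegral_enorm_causalConv_sq_le (hk ξ).1 (hc.1 ξ)).trans ?_
  rw [ENNReal.coe_pow]
  gcongr
  exact hB ξ

end IsL2Family

end SquareSummableFamilies

/-! ### Passing between `H`-valued functions and their coordinates. -/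

section Coordinates

open Set Filter Topology

variable {𝕜 ι H : Type*} [RCLike 𝕜] [NormedAddCommGroup H] [InnerProductSpace 𝕜 H]

theorem HilbertBasis.tsum_enorm_sq_repr (e : HilbertBasis ι 𝕜 H) (x : H) :
    ∑' ξ, ‖e.repr x ξ‖ₑ ^ 2 = ‖x‖ₑ ^ 2 := by
  have h := lp.hasSum_norm (p := 2) (by simp) (e.repr x)
  simp only [LinearIsometryEquiv.norm_map, ENNReal.toReal_ofNat, Real.rpow_two] at h
  have h2 : ∀ {E : Type _} [NormedAddCommGroup E] (y : E), ‖y‖ₑ ^ 2 = ENNReal.ofReal (‖y‖ ^ 2) :=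
    fun y => by rw [ENNReal.ofReal_pow (norm_nonneg _), ofReal_norm]
  rw [h2, ← h.tsum_eq, ENNReal.ofReal_tsum_of_nonneg (fun _ => by positivity) h.summable]
  exact tsum_congr fun ξ => by rw [ENNReal.ofReal_pow (norm_nonneg _), ofReal_norm]

open Classical in
/-- The vector with given square summable coordinates in a Hilbert basis (and `0` if the
coordinates are not square summable). -/
noncomputable def HilbertBasis.synth (e : HilbertBasis ι 𝕜 H) (c : ι → 𝕜) : H :=
  if h : Memℓp c 2 then e.repr.symm (⟨c, h⟩ : lp (fun _ : ι => 𝕜) 2) else 0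

theorem HilbertBasis.repr_synth (e : HilbertBasis ι 𝕜 H) {c : ι → 𝕜} (h : Memℓp c 2) (ξ : ι) :
    e.repr (e.synth c) ξ = c ξ := by
  rw [HilbertBasis.synth, dif_pos h, LinearIsometryEquiv.apply_symm_apply]

theorem HilbertBasis.ext_repr (e : HilbertBasis ι 𝕜 H) {x y : H}
    (h : ∀ ξ, e.repr x ξ = e.repr y ξ) : x = y :=
  e.repr.injective (lp.ext (funext h))

theorem HilbertBasis.memℓp_repr (e : HilbertBasis ι 𝕜 H) (x : H) :
    Memℓp (fun ξ => e.repr x ξ) 2 := lp.memℓp (e.repr x)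

/-- Definitional: both sides branch on the same square summability condition, with default 0. -/
theorem opApply_diagonalOperator (e : HilbertBasis ι 𝕜 H) (a : ι → ℝ) (x : H) :
    opApply (diagonalOperator e a) x = e.synth fun ξ => (a ξ : 𝕜) * e.repr x ξ := rfl

theorem mem_diagonalOperator_domain {e : HilbertBasis ι 𝕜 H} {a : ι → ℝ} {x : H} :
    x ∈ (diagonalOperator e a).domain ↔ Memℓp (fun ξ => a ξ • e.repr x ξ) 2 := by
  simp only [RCLike.real_smul_eq_coe_mul]
  rfl

theorem repr_opApply_diagonalOperator {e : HilbertBasis ι 𝕜 H} {a : ι → ℝ} {x : H}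
    (hx : x ∈ (diagonalOperator e a).domain) (ξ : ι) :
    e.repr (opApply (diagonalOperator e a) x) ξ = a ξ • e.repr x ξ := by
  rw [opApply_diagonalOperator, e.repr_synth hx, RCLike.real_smul_eq_coe_mul]

variable {Ω : Type*} [MeasurableSpace Ω] {μ : Measure Ω}

theorem HilbertBasis.aestronglyMeasurable_repr (e : HilbertBasis ι 𝕜 H) {g : Ω → H}
    (hg : AEStronglyMeasurable g μ) (ξ : ι) :
    AEStronglyMeasurable (fun t => e.repr (g t) ξ) μ := by
  simp only [e.repr_apply_apply]
  exact (innerSL 𝕜 (e ξ)).continuous.comp_aestronglyMeasurable hg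

theorem HilbertBasis.aestronglyMeasurable_of_repr [Countable ι] (e : HilbertBasis ι 𝕜 H)
    {g : Ω → H} (hg : ∀ ξ, AEStronglyMeasurable (fun t => e.repr (g t) ξ) μ) :
    AEStronglyMeasurable g μ :=
  aestronglyMeasurable_of_tendsto_ae atTop
    (f := fun (s : Finset ι) t => ∑ ξ ∈ s, e.repr (g t) ξ • e ξ)
    (fun s => Finset.aestronglyMeasurable_fun_sum s fun ξ _ => (hg ξ).smul_const _)
    (.of_forall fun t => e.hasSum_repr (g t))

theorem HilbertBasis.isL2Family_repr [Countable ι] (e : HilbertBasis ι 𝕜 H) {g : Ω → H}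
    (hg : MemLp g 2 μ) : IsL2Family μ (fun ξ t => e.repr (g t) ξ) := by
  refine ⟨e.aestronglyMeasurable_repr hg.1, ?_⟩
  rw [← lintegral_tsum fun ξ => (e.aestronglyMeasurable_repr hg.1 ξ).enorm.pow_const 2]
  simp only [e.tsum_enorm_sq_repr]
  exact (memLp_two_iff_lintegral.1 hg).2.ne

theorem IsL2Family.memLp_of_repr [Countable ι] (e : HilbertBasis ι 𝕜 H) {c : ι → Ω → 𝕜}
    (hc : IsL2Family μ c) {g : Ω → H} (hg : ∀ ξ, (fun t => e.repr (g t) ξ) =ᵐ[μ] c ξ) :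
    MemLp g 2 μ := by
  have hm : ∀ ξ, AEStronglyMeasurable (fun t => e.repr (g t) ξ) μ :=
    fun ξ => (hc.1 ξ).congr (hg ξ).symm
  refine memLp_two_iff_lintegral.2 ⟨e.aestronglyMeasurable_of_repr hm, ?_⟩
  simp only [← e.tsum_enorm_sq_repr]
  rw [lintegral_tsum fun ξ => (hm ξ).enorm.pow_const 2]
  refine lt_top_iff_ne_top.2 (ne_of_eq_of_ne (tsum_congr fun ξ => lintegral_congr_ae ?_) hc.2)
  filter_upwards [hg ξ] with t ht
  rw [ht]

theorem ae_mem_domain_of_isL2Family [Countable ι] (e : HilbertBasis ι 𝕜 H) {a : ι → ℝ}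
    {c : ι → Ω → 𝕜} (hca : IsL2Family μ fun ξ t => a ξ • c ξ t) {g : Ω → H}
    (hg : ∀ ξ, (fun t => e.repr (g t) ξ) =ᵐ[μ] c ξ) :
    ∀ᵐ t ∂μ, g t ∈ (diagonalOperator e a).domain := by
  filter_upwards [hca.ae_memℓp, ae_all_iff.2 hg] with t h1 h2
  rw [mem_diagonalOperator_domain]
  simpa only [h2] using h1

theorem repr_opApply_ae (e : HilbertBasis ι 𝕜 H) {a : ι → ℝ}
    {c : ι → Ω → 𝕜} {g : Ω → H} (hd : ∀ᵐ t ∂μ, g t ∈ (diagonalOperator e a).domain)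
    (hg : ∀ ξ, (fun t => e.repr (g t) ξ) =ᵐ[μ] c ξ) (ξ : ι) :
    (fun t => e.repr (opApply (diagonalOperator e a) (g t)) ξ) =ᵐ[μ] fun t => a ξ • c ξ t := by
  filter_upwards [hd, hg ξ] with t h1 h2
  rw [repr_opApply_diagonalOperator h1, h2]

theorem memL2Domain_of_isL2Family [Countable ι] (e : HilbertBasis ι 𝕜 H) {a : ι → ℝ} {T : ℝ}
    {c : ι → ℝ → 𝕜} (hc : IsL2Family (volume.restrict (Ioc 0 T)) c)
    (hca : IsL2Family (volume.restrict (Ioc 0 T)) fun ξ t => a ξ • c ξ t) {g : ℝ → H}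
    (hg : ∀ ξ, (fun t => e.repr (g t) ξ) =ᵐ[volume.restrict (Ioc 0 T)] c ξ) :
    MemL2Domain (diagonalOperator e a) T g :=
  have hd := ae_mem_domain_of_isL2Family e hca hg
  ⟨hd, hc.memLp_of_repr e hg, hca.memLp_of_repr e (repr_opApply_ae e hd hg)⟩

theorem HilbertBasis.integrableOn_repr (e : HilbertBasis ι 𝕜 H) {g : ℝ → H} {s : Set ℝ}
    (hg : IntegrableOn g s) (ξ : ι) : IntegrableOn (fun t => e.repr (g t) ξ) s := by
  simp only [e.repr_apply_apply]
  exact (innerSL 𝕜 (e ξ)).integrable_comp hg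

variable [NormedSpace ℝ H]

theorem repr_integral [CompleteSpace H] (e : HilbertBasis ι 𝕜 H) {g : ℝ → H} {a b : ℝ}
    (hg : IntervalIntegrable g volume a b) (ξ : ι) :
    e.repr (∫ s in a..b, g s) ξ = ∫ s in a..b, e.repr (g s) ξ := by
  simp only [e.repr_apply_apply]
  exact ((innerSL 𝕜 (e ξ)).intervalIntegral_comp_comm hg).symm

variable [IsScalarTower ℝ 𝕜 H]

/-- The real scalar action on `H` is an independent instance; `IsScalarTower` ties it to the action
of 𝕜. -/
theorem repr_real_smul (e : HilbertBasis ι 𝕜 H) (r : ℝ) (x : H) (ξ : ι) :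
    e.repr (r • x) ξ = r • e.repr x ξ := by
  rw [← algebraMap_smul 𝕜 r x, map_smul, lp.coeFn_smul, Pi.smul_apply, algebraMap_smul]

variable [CompleteSpace H]

theorem repr_causalConv_ae (e : HilbertBasis ι 𝕜 H) {k : ℝ → ℝ} {g : ℝ → H} {T : ℝ}
    (hk : IntegrableOn k (Ioc 0 T)) (hg : IntegrableOn g (Ioc 0 T)) :
    ∀ᵐ t ∂volume.restrict (Ioc 0 T), ∀ ξ, e.repr (causalConv k g t) ξ
      = causalConv k (fun s => e.repr (g s) ξ) t := by
  filter_upwards [causalConv_integrand_ae hk hg] with t ht ξ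
  rw [causalConv, repr_integral e ht ξ]
  simp only [repr_real_smul]
  rfl

/-- Coordinates commute with Bochner integrals, and countably many exceptional null sets can be
merged. Integrability in `H` is assumed since it does not follow from that of the coordinates. -/
theorem hasCaputoDeriv_iff_repr [Countable ι] (e : HilbertBasis ι 𝕜 H) {α T : ℝ} (hα1 : α < 1)
    {g v : ℝ → H} (hg : IntegrableOn g (Ioc 0 T)) (hv : IntegrableOn v (Ioc 0 T)) :
    HasCaputoDeriv α T g v ↔
      ∀ ξ, HasCaputoDeriv α T (fun t => e.repr (g t) ξ) (fun t => e.repr (v t) ξ) := by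
  have hc : IntegrableOn (fun _ => g 0) (Ioc 0 T) := integrableOn_const (by simp)
  have hrepr := repr_causalConv_ae e (integrableOn_fracKernel (sub_pos.2 hα1)) (hg.sub hc)
  have key : ∀ᵐ t ∂volume.restrict (Ioc 0 T),
      (rlIntegral (1 - α) (fun s => g s - g 0) t = ∫ s in (0 : ℝ)..t, v s) ↔
      ∀ ξ, rlIntegral (1 - α) (fun s => e.repr (g s) ξ - e.repr (g 0) ξ) t
        = ∫ s in (0 : ℝ)..t, e.repr (v s) ξ := by
    filter_upwards [hrepr, ae_restrict_mem measurableSet_Ioc] with t h1 ht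
    have h2 : ∀ ξ, e.repr (rlIntegral (1 - α) (fun s => g s - g 0) t) ξ
        = rlIntegral (1 - α) (fun s => e.repr (g s) ξ - e.repr (g 0) ξ) t := fun ξ => by
      rw [rlIntegral_eq_causalConv, rlIntegral_eq_causalConv]
      refine (h1 ξ).trans ?_
      simp
    simp only [← h2, ← repr_integral e (intervalIntegrable_of_mem hv ht)]
    exact ⟨fun h ξ => by rw [h], e.ext_repr⟩
  constructor
  · intro h ξ
    refine ⟨e.integrableOn_repr hg ξ, e.integrableOn_repr hv ξ, ?_⟩
    filter_upwards [key, h.2.2] with t h1 h2 using h1.1 h2 ξ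
  · intro h
    refine ⟨hg, hv, ?_⟩
    filter_upwards [key, ae_all_iff.2 fun ξ => (h ξ).2.2] with t h1 h2 using h1.2 h2

end Coordinates

/-! ### Estimates uniform in ξ for the solution families. -/

section RelaxationFamilies

open Set Filter Topology

variable {𝕜 ι : Type*} [RCLike 𝕜]

theorem enorm_mlKernel_le {α c : ℝ} (hα : 0 < α) (hα1 : α < 1) (hc : 0 < c) {t : ℝ} (ht : 0 < t) :
    ‖mlKernel α α c t‖ₑ ≤ ‖fracKernel α t‖ₑ := by
  rw [Real.enorm_of_nonneg (mlKernel_pos hα hα1 hc ht).le,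
    Real.enorm_of_nonneg (fracKernel_pos hα ht).le]
  exact ENNReal.ofReal_le_ofReal (mlKernel_le_fracKernel hα hα1 hc ht)

/-- k_α² is a multiple of k_{2α-1}, integrable at 0 because 2α-1 > 0; this is where α > 1/2 matters.
-/
theorem lintegral_fracKernel_sq_ne_top {α : ℝ} (hα : 1 / 2 < α) {T : ℝ} :
    ∫⁻ s in Ioc 0 T, ‖fracKernel α s‖ₑ ^ 2 ≠ ⊤ := by
  have hi : IntegrableOn (fun s => fracKernel α s ^ 2) (Ioc 0 T) := by
    have h := (integrableOn_fracKernel (β := 2 * α - 1) (T := T) (by linarith)).const_mul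
      (Real.Gamma (2 * α - 1) / Real.Gamma α ^ 2)
    refine h.congr ?_
    filter_upwards [ae_restrict_mem measurableSet_Ioc] with s hs
    have h1 := (Real.Gamma_pos_of_pos (by linarith : 0 < 2 * α - 1)).ne'
    have h2 := (Real.Gamma_pos_of_pos (by linarith : 0 < α)).ne'
    have h3 : s ^ (2 * α - 1 - 1) = (s ^ (α - 1)) ^ 2 := by
      rw [← Real.rpow_natCast, ← Real.rpow_mul hs.1.le]
      congr 1
      push_cast
      ring
    simp only [fracKernel, h3]
    field_simp
  have h := hi.2.ne
  simpa only [enorm_pow] using h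

theorem isL2Family_mittagLeffler_smul {α T : ℝ} (hα : 0 < α) (hα1 : α < 1) {c : ι → ℝ}
    (hc : ∀ ξ, 0 < c ξ) {a : ι → 𝕜} (ha : Memℓp a 2) :
    IsL2Family (volume.restrict (Ioc 0 T))
      (fun ξ t => mittagLeffler α 1 (-c ξ * t ^ α) • a ξ) := by
  refine (IsL2Family.const ha).smul (b := fun ξ t => mittagLeffler α 1 (-c ξ * t ^ α)) (C := 1)
    (fun ξ => ?_) fun ξ => ?_
  · exact ((continuous_mittagLeffler hα hα1 one_pos).comp
      (continuous_const.mul (Real.continuous_rpow_const hα.le))).aestronglyMeasurable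
  · filter_upwards [ae_restrict_mem measurableSet_Ioc] with t ht
    have h := mittagLeffler_one_mem_Icc hα hα1 (hc ξ) ht.1.le
    exact abs_le.2 ⟨by linarith [h.1], h.2⟩

theorem memℓp_mittagLeffler_smul {α t : ℝ} (hα : 0 < α) (hα1 : α < 1) (ht : 0 ≤ t) {c : ι → ℝ}
    (hc : ∀ ξ, 0 < c ξ) {a : ι → 𝕜} (ha : Memℓp a 2) :
    Memℓp (fun ξ => mittagLeffler α 1 (-c ξ * t ^ α) • a ξ) 2 := by
  refine ha.of_norm_le (C := 1) fun ξ => ?_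
  have h := mittagLeffler_one_mem_Icc hα hα1 (hc ξ) ht
  rw [norm_smul]
  gcongr
  exact abs_le.2 ⟨by linarith [h.1], h.2⟩

namespace IsL2Family

variable {α T : ℝ} {c : ι → ℝ} {h : ι → ℝ → 𝕜}

theorem causalConv_mlKernel (hh : IsL2Family (volume.restrict (Ioc 0 T)) h) (hα : 0 < α)
    (hα1 : α < 1) (hc : ∀ ξ, 0 < c ξ) :
    IsL2Family (volume.restrict (Ioc 0 T))
      (fun ξ => _root_.causalConv (mlKernel α α (c ξ)) (h ξ)) := by
  have hk := (integrableOn_fracKernel hα (T := T)).2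
  refine hh.causalConv (B := (∫⁻ s in Ioc 0 T, ‖fracKernel α s‖ₑ).toNNReal)
    (fun ξ => integrableOn_mlKernel hα hα1 hα (c ξ)) fun ξ => ?_
  rw [ENNReal.coe_toNNReal hk.ne]
  exact setLIntegral_mono_ae' measurableSet_Ioc
    (.of_forall fun s hs => enorm_mlKernel_le hα hα1 (hc ξ) hs.1)

/-- Maximal regularity: multiplication by `c` is bounded after convolution with the resolvent,
uniformly in `c`. -/
theorem smul_causalConv_mlKernel (hh : IsL2Family (volume.restrict (Ioc 0 T)) h) (hα : 0 < α)
    (hα1 : α < 1) (hT : 0 < T) (hc : ∀ ξ, 0 < c ξ) :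
    IsL2Family (volume.restrict (Ioc 0 T))
      (fun ξ t => c ξ • _root_.causalConv (mlKernel α α (c ξ)) (h ξ) t) := by
  simp only [← causalConv_const_mul_left]
  refine hh.causalConv (k := fun ξ s => c ξ * mlKernel α α (c ξ) s) (B := 1)
    (fun ξ => (integrableOn_mlKernel hα hα1 hα (c ξ)).const_mul _) fun ξ => ?_
  simp only [enorm_mul]
  rw [lintegral_const_mul' _ _ enorm_ne_top, Real.enorm_of_nonneg (hc ξ).le]
  exact mul_lintegral_mlKernel_le_one hα hα1 (hc ξ) hT

/-- Cauchy-Schwarz at a fixed t, with ‖e_c‖₂ ≤ ‖k_α‖₂ for every c, gives summability at each t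
without an exceptional set. -/
theorem memℓp_causalConv_mlKernel (hh : IsL2Family (volume.restrict (Ioc 0 T)) h)
    (hα : 1 / 2 < α) (hα1 : α < 1) (hc : ∀ ξ, 0 < c ξ) {t : ℝ} (ht : t ∈ Icc 0 T) :
    Memℓp (fun ξ => _root_.causalConv (mlKernel α α (c ξ)) (h ξ) t) 2 := by
  have hα0 : 0 < α := by linarith
  rw [memℓp_two_iff_tsum_enorm]
  refine ne_top_of_le_ne_top
    (ENNReal.mul_ne_top (lintegral_fracKernel_sq_ne_top hα (T := T)) hh.2) ?_
  rw [← ENNReal.tsum_mul_left]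
  refine ENNReal.tsum_le_tsum fun ξ => (enorm_causalConv_sq_le ht
    (aestronglyMeasurable_mlKernel hα0 hα1 hα0 (c ξ) T) (hh.1 ξ)).trans ?_
  gcongr ?_ * _
  refine setLIntegral_mono_ae' measurableSet_Ioc (.of_forall fun s hs => ?_)
  gcongr
  exact enorm_mlKernel_le hα0 hα1 (hc ξ) hs.1

theorem sub {g : ι → ℝ → 𝕜}
    (hh : IsL2Family (volume.restrict (Ioc 0 T)) h)
    (hg : IsL2Family (volume.restrict (Ioc 0 T)) g) :
    IsL2Family (volume.restrict (Ioc 0 T)) (fun ξ t => h ξ t - g ξ t) := by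
  have h1 := hh.add (hg.const_smul (b := fun _ => -1) (C := 1) (by simp))
  simpa [sub_eq_add_neg] using h1

end IsL2Family

end RelaxationFamilies

/-! ### Reduction to coordinates, uniqueness, and assembly of solutions. -/

section GeneralisedSolutions

theorem self_add_smul {R V : Type*} [Semiring R] [AddCommMonoid V] [Module R V] (r : R) (x : V) :
    x + r • x = (1 + r) • x := by
  rw [add_smul, one_smul]

open Set Filter Topology

variable {𝕜 ι H : Type*} [RCLike 𝕜] [Countable ι] [NormedAddCommGroup H] [InnerProductSpace 𝕜 H]
  [CompleteSpace H] [NormedSpace ℝ H] [IsScalarTower ℝ 𝕜 H]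

theorem IsGeneralisedSolution.hasCaputoDeriv_repr {e : HilbertBasis ι 𝕜 H} {lam mu : ι → ℝ}
    (hlam : ∀ ξ, 0 < 1 + lam ξ) {α T : ℝ} (hα1 : α < 1) {f : ℝ → H} {φ : H}
    (hφ : φ ∈ (diagonalOperator e lam).domain) {w : ℝ → H}
    (hw : IsGeneralisedSolution (diagonalOperator e lam) (diagonalOperator e mu) α T f φ w)
    (ξ : ι) :
    HasCaputoDeriv α T (fun t => e.repr (w t) ξ)
      (fun t => (1 + lam ξ)⁻¹ • e.repr (f t) ξ - (mu ξ / (1 + lam ξ)) • e.repr (w t) ξ) := by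
  obtain ⟨g, hg, hgf⟩ := hw.equation
  have h1 := (hasCaputoDeriv_iff_repr e hα1 hg.1 hg.2.1).1 hg ξ
  refine (h1.const_smul (1 + lam ξ)⁻¹).congr_ae ?_ ?_ ?_
  · filter_upwards [hw.memW.2.1.1] with t ht
    rw [map_add, lp.coeFn_add, Pi.add_apply, repr_opApply_diagonalOperator ht, self_add_smul,
      inv_smul_smul₀ (hlam ξ).ne']
  -- φ ∈ D(L) is essential here: off the domain `opApply` would return 0 in place of Lφ.
  · rw [hw.initial, map_add, lp.coeFn_add, Pi.add_apply, repr_opApply_diagonalOperator hφ,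
      self_add_smul, inv_smul_smul₀ (hlam ξ).ne']
  · filter_upwards [hgf, hw.memL2.1] with t ht hd
    rw [← ht, map_add, lp.coeFn_add, Pi.add_apply, repr_opApply_diagonalOperator hd]
    module

theorem IsGeneralisedSolution.ae_eq {e : HilbertBasis ι 𝕜 H} {lam mu : ι → ℝ}
    (hlam : ∀ ξ, 0 < 1 + lam ξ) {α T : ℝ} (hα : 0 < α) (hα1 : α < 1) {f : ℝ → H} {φ : H}
    (hφ : φ ∈ (diagonalOperator e lam).domain) {w u : ℝ → H}
    (hw : IsGeneralisedSolution (diagonalOperator e lam) (diagonalOperator e mu) α T f φ w)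
    (hu : IsGeneralisedSolution (diagonalOperator e lam) (diagonalOperator e mu) α T f φ u) :
    w =ᵐ[volume.restrict (Ioc 0 T)] u := by
  have h : ∀ ξ, (fun t => e.repr (w t) ξ) =ᵐ[volume.restrict (Ioc 0 T)]
      fun t => e.repr (u t) ξ := fun ξ =>
    ae_eq_of_relaxation hα hα1 (by rw [hw.initial, hu.initial])
      (hw.hasCaputoDeriv_repr hlam hα1 hφ ξ) (hu.hasCaputoDeriv_repr hlam hα1 hφ ξ)
  filter_upwards [ae_all_iff.2 h] with t ht using e.ext_repr ht

/-- A family of solutions of the coordinate equations with the right integrability assembles to a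
generalised solution. -/
theorem isGeneralisedSolution_of_repr {e : HilbertBasis ι 𝕜 H} {lam mu : ι → ℝ}
    (hlam : ∀ ξ, 0 < lam ξ) {α T : ℝ} (hα1 : α < 1) {f : ℝ → H} {φ : H}
    (hφ : φ ∈ (diagonalOperator e lam).domain)
    (hf : MemLp f 2 (volume.restrict (Ioc 0 T))) {u : ℝ → H} {y : ι → ℝ → 𝕜} (hu0 : u 0 = φ)
    (hu : ∀ ξ, ∀ t ∈ Icc 0 T, e.repr (u t) ξ = y ξ t) (hT : 0 ≤ T)
    (hy : IsL2Family (volume.restrict (Ioc 0 T)) y)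
    (hLy : IsL2Family (volume.restrict (Ioc 0 T)) fun ξ t => lam ξ • y ξ t)
    (hMy : IsL2Family (volume.restrict (Ioc 0 T)) fun ξ t => mu ξ • y ξ t)
    (heq : ∀ ξ, HasCaputoDeriv α T (y ξ)
      (fun t => (1 + lam ξ)⁻¹ • (e.repr (f t) ξ - mu ξ • y ξ t))) :
    IsGeneralisedSolution (diagonalOperator e lam) (diagonalOperator e mu) α T f φ u := by
  set ν := volume.restrict (Ioc (0 : ℝ) T) with hν
  have hua : ∀ ξ, (fun t => e.repr (u t) ξ) =ᵐ[ν] y ξ := fun ξ => by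
    filter_upwards [ae_restrict_mem measurableSet_Ioc] with t ht
      using hu ξ t ⟨ht.1.le, ht.2⟩
  have hy0 : ∀ ξ, e.repr φ ξ = y ξ 0 := fun ξ => by rw [← hu0, hu ξ 0 ⟨le_rfl, hT⟩]
  set v : ι → ℝ → 𝕜 := fun ξ t => (1 + lam ξ)⁻¹ • (e.repr (f t) ξ - mu ξ • y ξ t) with hv
  have hpos : ∀ ξ, 0 < 1 + lam ξ := fun ξ => by linarith [hlam ξ]
  have hG := (e.isL2Family_repr hf).sub hMy
  have hvf : IsL2Family ν v := hG.const_smul (C := 1) fun ξ => by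
    rw [abs_of_pos (inv_pos.2 (hpos ξ))]
    exact inv_le_one_of_one_le₀ (by linarith [hlam ξ])
  -- λ/(1+λ) ≤ 1, so L costs nothing on the candidate derivative.
  have hLvf : IsL2Family ν fun ξ t => lam ξ • v ξ t := by
    simp only [hv, smul_smul]
    refine hG.const_smul (C := 1) fun ξ => ?_
    rw [abs_of_pos (mul_pos (hlam ξ) (inv_pos.2 (hpos ξ))), ← div_eq_mul_inv,
      div_le_one (hpos ξ)]
    linarith
  -- On the null set where the coordinates are not square summable, V takes the default value 0.
  set V : ℝ → H := fun t => e.synth fun ξ => v ξ t with hV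
  have hVa : ∀ ξ, (fun t => e.repr (V t) ξ) =ᵐ[ν] v ξ := fun ξ => by
    filter_upwards [hvf.ae_memℓp] with t ht using e.repr_synth ht ξ
  have huL : MemL2Domain (diagonalOperator e lam) T u := memL2Domain_of_isL2Family e hy hLy hua
  have huM : MemL2Domain (diagonalOperator e mu) T u := memL2Domain_of_isL2Family e hy hMy hua
  have hVL : MemL2Domain (diagonalOperator e lam) T V := memL2Domain_of_isL2Family e hvf hLvf hVa
  have hint : ∀ {g : ℝ → H}, MemLp g 2 ν → IntegrableOn g (Ioc 0 T) :=
    fun hg => hg.integrable (by norm_num)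
  have hLu := repr_opApply_ae e huL.1 hua
  have hLV := repr_opApply_ae e hVL.1 hVa
  have hMu := repr_opApply_ae e huM.1 hua
  have hL0 : ∀ ξ, e.repr (opApply (diagonalOperator e lam) (u 0)) ξ = lam ξ • y ξ 0 := fun ξ => by
    rw [hu0, repr_opApply_diagonalOperator hφ, hy0]
  have hcap : HasCaputoDeriv α T u V :=
    (hasCaputoDeriv_iff_repr e hα1 (hint huL.2.1) (hint hVL.2.1)).2 fun ξ =>
      (heq ξ).congr_ae (hua ξ).symm (by rw [hu0, hy0]) (hVa ξ).symm
  have hcapL : HasCaputoDeriv α T (fun t => opApply (diagonalOperator e lam) (u t))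
      (fun t => opApply (diagonalOperator e lam) (V t)) :=
    (hasCaputoDeriv_iff_repr e hα1 (hint huL.2.2) (hint hVL.2.2)).2 fun ξ =>
      ((heq ξ).const_smul (lam ξ)).congr_ae (hLu ξ).symm (hL0 ξ).symm (hLV ξ).symm
  -- Taking f - Mu as the derivative of u + Lu makes the equation automatic; the content is that it
  -- is the Caputo derivative.
  refine ⟨huM, ⟨hu0 ▸ hφ, huL, V, hVL, hcap, hcapL⟩, hu0,
    fun t => f t - opApply (diagonalOperator e mu) (u t), ?_,
    .of_forall fun t => sub_add_cancel _ _⟩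
  refine (hasCaputoDeriv_iff_repr e hα1 (g := fun t => u t + opApply (diagonalOperator e lam) (u t))
    (v := fun t => f t - opApply (diagonalOperator e mu) (u t)) ((hint huL.2.1).add (hint huL.2.2))
    ((hint hf).sub (hint huM.2.2))).2 fun ξ => ?_
  refine ((heq ξ).const_smul (1 + lam ξ)).congr_ae ?_ ?_ ?_
  · filter_upwards [hua ξ, hLu ξ] with t h1 h2
    rw [map_add, lp.coeFn_add, Pi.add_apply, h1, h2, add_smul, one_smul]
  · rw [map_add, lp.coeFn_add, Pi.add_apply, hL0, hu0, hy0, add_smul, one_smul]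
  · filter_upwards [hMu ξ] with t h1
    rw [map_sub, lp.coeFn_sub, Pi.sub_apply, h1, smul_inv_smul₀ (hpos ξ).ne']

end GeneralisedSolutions

/-! ### The main theorem. -/

theorem theorem2p1 {𝕜 ι H : Type*} [RCLike 𝕜] [Countable ι]
    [NormedAddCommGroup H] [InnerProductSpace 𝕜 H] [CompleteSpace H]
    [TopologicalSpace.SeparableSpace H] [NormedSpace ℝ H] [IsScalarTower ℝ 𝕜 H]
    (e : HilbertBasis ι 𝕜 H) (lam mu : ι → ℝ) (cL cM : ℝ) (hcL : 0 < cL) (hcM : 0 < cM)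
    (hlam : ∀ ξ, cL ≤ lam ξ) (hmu : ∀ ξ, cM ≤ mu ξ)
    (L M : H →ₗ.[𝕜] H) (hL : L = diagonalOperator e lam) (hM : M = diagonalOperator e mu)
    (α T : ℝ) (hα : 1 / 2 < α) (hα1 : α < 1) (hT : 0 < T)
    (φ : H) (hφL : φ ∈ L.domain) (hφM : φ ∈ M.domain)
    (f : ℝ → H) (hf : MemLp f 2 (volume.restrict (Set.Ioc 0 T)))
    (hfLM : MemL2Domain (jointPower e lam mu (-1) 1) T f) :
    ∃ u : ℝ → H,
      IsGeneralisedSolution L M α T f φ u ∧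
      (∀ w : ℝ → H, IsGeneralisedSolution L M α T f φ w →
        w =ᵐ[volume.restrict (Set.Ioc 0 T)] u) ∧
      ∀ t ∈ Set.Icc 0 T, ∃ S₁ S₂ : H,
        HasSum (fun ξ =>
          (inner 𝕜 (e ξ) φ * (mittagLeffler α 1 (-(mu ξ / (1 + lam ξ)) * t ^ α) : 𝕜)) • e ξ) S₁ ∧
        HasSum (fun ξ =>
          (((1 / (1 + lam ξ) : ℝ) : 𝕜) * ∫ s in (0 : ℝ)..t,
            ((s ^ (α - 1) * mittagLeffler α α (-(mu ξ / (1 + lam ξ)) * s ^ α) : ℝ) : 𝕜) *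
              inner 𝕜 (e ξ) (f (t - s))) • e ξ) S₂ ∧
        u t = S₁ + S₂ := by
  subst hL hM
  have hα0 : 0 < α := by linarith
  have hlam0 : ∀ ξ, 0 < lam ξ := fun ξ => hcL.trans_le (hlam ξ)
  have hpos : ∀ ξ, 0 < 1 + lam ξ := fun ξ => by linarith [hlam0 ξ]
  have hmu0 : ∀ ξ, 0 < mu ξ := fun ξ => hcM.trans_le (hmu ξ)
  set c : ι → ℝ := fun ξ => mu ξ / (1 + lam ξ) with hcdef
  have hc : ∀ ξ, 0 < c ξ := fun ξ => div_pos (hmu0 ξ) (hpos ξ)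
  set F : ι → ℝ → 𝕜 := fun ξ t => e.repr (f t) ξ with hF
  have hFf : IsL2Family (volume.restrict (Set.Ioc 0 T)) F := e.isL2Family_repr hf
  have hinv : ∀ ξ, |(1 + lam ξ)⁻¹| ≤ 1 := fun ξ => by
    rw [abs_of_pos (inv_pos.2 (hpos ξ))]
    exact inv_le_one_of_one_le₀ (by linarith [hlam0 ξ])
  have hh := hFf.const_smul hinv
  set h : ι → ℝ → 𝕜 := fun ξ t => (1 + lam ξ)⁻¹ • F ξ t with hh'
  set y₁ : ι → ℝ → 𝕜 := fun ξ t => mittagLeffler α 1 (-c ξ * t ^ α) • e.repr φ ξ with hy₁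
  set y₂ : ι → ℝ → 𝕜 := fun ξ => causalConv (mlKernel α α (c ξ)) (h ξ) with hy₂
  have hm₁ : ∀ t ∈ Set.Icc 0 T, Memℓp (fun ξ => y₁ ξ t) 2 := fun t ht =>
    memℓp_mittagLeffler_smul hα0 hα1 ht.1 hc (e.memℓp_repr φ)
  have hm₂ : ∀ t ∈ Set.Icc 0 T, Memℓp (fun ξ => y₂ ξ t) 2 := fun t ht =>
    hh.memℓp_causalConv_mlKernel hα hα1 hc ht
  have hrelax : ∀ ξ, HasCaputoDeriv α T (fun t => y₁ ξ t + y₂ ξ t)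
      (fun t => (1 + lam ξ)⁻¹ • (e.repr (f t) ξ - mu ξ • (y₁ ξ t + y₂ ξ t))) := fun ξ => by
    refine (hasCaputoDeriv_relaxation (c := c ξ) hα0 hα1 (e.repr φ ξ) (hh.integrable ξ)
      (fun t => rfl)).congr_ae (.refl _ _) rfl (.of_forall fun t => ?_)
    simp only [hh', hF, hcdef]
    module
  -- λ commutes with both parts: it acts on the coordinates of φ ∈ D(L), and λ/(1+λ) ≤ 1 absorbs it
  -- in the part from f.
  have hLy : IsL2Family (volume.restrict (Set.Ioc 0 T))
      fun ξ t => lam ξ • (y₁ ξ t + y₂ ξ t) := by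
    have h1 := isL2Family_mittagLeffler_smul (T := T) hα0 hα1 hc
      (mem_diagonalOperator_domain.1 hφL)
    have h2 := (hFf.const_smul (b := fun ξ => lam ξ * (1 + lam ξ)⁻¹) (C := 1) fun ξ => by
      rw [abs_of_pos (mul_pos (hlam0 ξ) (inv_pos.2 (hpos ξ))), ← div_eq_mul_inv,
        div_le_one (hpos ξ)]
      linarith).causalConv_mlKernel hα0 hα1 hc
    convert h1.add h2 using 3 with ξ t
    simp only [hy₁, hy₂, hh', smul_add, causalConv_const_smul_right, smul_smul]
    rw [mul_comm (lam ξ) (mittagLeffler _ _ _)]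
  -- On the part from f, μ/(1+λ) is exactly the parameter c, so maximal regularity applies with f
  -- itself as the source.
  have hMy : IsL2Family (volume.restrict (Set.Ioc 0 T))
      fun ξ t => mu ξ • (y₁ ξ t + y₂ ξ t) := by
    have h1 := isL2Family_mittagLeffler_smul (T := T) hα0 hα1 hc
      (mem_diagonalOperator_domain.1 hφM)
    have h2 := hFf.smul_causalConv_mlKernel hα0 hα1 hT hc
    convert h1.add h2 using 3 with ξ t
    simp only [hy₁, hy₂, hh', smul_add, causalConv_const_smul_right, smul_smul, hcdef,
      div_eq_mul_inv]
    rw [mul_comm (mu ξ) (mittagLeffler _ _ _)]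
  -- The two parts are synthesised separately because each series has to converge by itself.
  have hsol : IsGeneralisedSolution (diagonalOperator e lam) (diagonalOperator e mu) α T f φ
      (fun t => e.synth (fun ξ => y₁ ξ t) + e.synth (fun ξ => y₂ ξ t)) := by
    have hrepr : ∀ ξ, ∀ t ∈ Set.Icc 0 T,
        e.repr (e.synth (fun ξ => y₁ ξ t) + e.synth (fun ξ => y₂ ξ t)) ξ = y₁ ξ t + y₂ ξ t := by
      intro ξ t ht
      rw [map_add, lp.coeFn_add, Pi.add_apply, e.repr_synth (hm₁ t ht), e.repr_synth (hm₂ t ht)]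
    refine isGeneralisedSolution_of_repr hlam0 hα1 hφL hf (e.ext_repr fun ξ => ?_) hrepr hT.le
      ((isL2Family_mittagLeffler_smul hα0 hα1 hc (e.memℓp_repr φ)).add
        (hh.causalConv_mlKernel hα0 hα1 hc)) hLy hMy hrelax
    rw [hrepr ξ 0 ⟨le_rfl, hT.le⟩]
    simp [hy₁, hy₂, causalConv_zero_time, Real.zero_rpow hα0.ne', mittagLeffler_zero]
  refine ⟨_, hsol, fun w hw => hw.ae_eq hpos hα0 hα1 hφL hsol, fun t ht =>
    ⟨_, _, ?_, ?_, rfl⟩⟩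
  · refine (e.hasSum_repr _).congr_fun fun ξ => ?_
    rw [e.repr_synth (hm₁ t ht)]
    simp only [hy₁]
    rw [RCLike.real_smul_eq_coe_mul, e.repr_apply_apply, mul_comm]
  · refine (e.hasSum_repr _).congr_fun fun ξ => ?_
    rw [e.repr_synth (hm₂ t ht)]
    simp only [hy₂, hh', hF, causalConv_const_smul_right]
    simp only [causalConv_eq_integral_comp_sub,
      RCLike.real_smul_eq_coe_mul, e.repr_apply_apply, one_div, mlKernel, hcdef]
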